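/- Let $m\ge 0$. Consider a fully actuated mechanical port-Hamiltonian system on $\mathbb R^m\times\mathbb R^m$ in the coordinates $x=(q,\eta)$, $\eta=T(q)^\top p$, $$\begin{pmatrix}\dot q\\ \dot\eta\end{pmatrix}=\begin{pmatrix}0&T(q)\\-T(q)^\top&-D(q,\eta)\end{pmatrix}\begin{pmatrix}\nabla_qH\\ \nabla_\eta H\end{pmatrix}+\begin{pmatrix}0\\G(q)\end{pmatrix}u,\qquad H=\tfrac12\|\eta\|^2,\tag{1}$$ where $M(q)$ is symmetric positive definite, $T$ is continuous with $T(q)T(q)^\top=M(q)^{-1}$, $G(q)=T(q)^\top G_0(q)$ with $G_0(q)$ nonsingular, and $D+D^\top\succeq0$. Let $U:\mathbb R^m\to\mathbb R$, and let $\phi:\mathbb R^m\times\mathbb R^m\to\mathbb R^m$ be $C^1$ with $\phi(0,0)=0$ and $\frac{\partial\phi}{\partial q},\frac{\partial\phi}{\partial\eta}$ nonsingular everywhere. Put $\sigma=\phi(q,\eta)$ and $$\Lambda=\frac{\partial\phi}{\partial q}T\frac{\partial\phi}{\partial\eta}^{\top}+\frac{\partial\phi}{\partial\eta}T^\top\frac{\partial\phi}{\partial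 q}^{\top},\qquad H_{\mathrm{smc}}(q,\eta)=\tfrac12\|\eta\|^2+U(\phi(q,\eta)),$$ $$J_{\mathrm{smc}}=\begin{pmatrix}-T\frac{\partial\phi}{\partial\eta}^{\top}\frac{\partial\phi}{\partial q}^{-\top}&T\\-T^\top&-\frac{\partial\phi}{\partial\eta}^{-1}\frac{\partial\phi}{\partial q}T\end{pmatrix}.$$ (a) At every state $(q,\eta)$ such that $U$ is differentiable at $\phi(q,\eta)$, the feedback $$u=-G^{-1}\frac{\partial\phi}{\partial\eta}^{-1}\Lambda\,\nabla U(\sigma)+G^{-1}\Big(D-\frac{\partial\phi}{\partial\eta}^{-1}\frac{\partial\phi}{\partial q}T\Big)\eta$$ turns the right-hand side of (1) into $J_{\mathrm{smc}}\nabla H_{\mathrm{smc}}$. If $U$ is locally Lipschitz, the same holds at every state for Clarke's generalized gradients: the set of right-hand sides obtained by letting $\nabla U(\sigma)$ range over $\partial U(\sigma)$ equals $J_{\mathrm{smc}}\,\partial H_{\mathrm{smc}}$. The closed loop is then the differential inclusion $$\dot x\in J_{\mathrm{smc}}(x)\,\partial H_{\mathrm{smc}}(x),\tag{2}$$ whose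 solutions are locally absolutely continuous curves satisfying it almost everywhere (so sub-sliding modes, in which some components $\sigma_i$ vanish identically, are included). (b) Assume moreover that - $U$ is locally Lipschitz and either (i) for each $i$ the partial derivative $\partial U/\partial\sigma_i$ exists and is continuous on $\{\sigma_i\ne0\}$, or (ii) $U$ is Clarke regular (e.g. $C^1$ or convex); - there is $\varepsilon>0$ with $\Lambda(q,\eta)\succ\varepsilon I$ for all $q,\eta$; - $U(0)=0$, $U(\sigma)>0$ for $\sigma\neq0$, and there are $c>0$, $0\le\rho<\frac12$ with $\|\xi\|\ge c\,U(\sigma)^\rho$ for all $\sigma\ne0$ and all $\xi\in\partial U(\sigma)$. Then: 1. For each initial state $x_0$ there is a finite time $t_s\ge 0$ such that every solution of (2) on an interval $[0,\tau)$, $\tau\le\infty$, with $x(0)=x_0$ satisfies $\sigma(t)=\phi(q(t),\eta(t))=0$ for all $t\in[t_s,\tau)$. 2. The origin of (2) is (locally) asymptotically stable: for every $r>0$ there is $\delta>0$ such that from each $x_0$ with $\|x_0\|<\delta$ there is a solution on $[0,\infty)$, and every solution from $x_0$ can be continued to $[0,\infty)$ and satisfies $\|x(t)\|<r$ on its interval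 of definition; and all solutions on $[0,\infty)$ that start sufficiently close to the origin converge to it as $t\to\infty$. 3. $H_{\mathrm{smc}}$ is a strict Lyapunov function: $H_{\mathrm{smc}}(0)=0$, and on some ball around the origin it is continuous and positive away from the origin, and along each solution of (2) inside this ball $\frac{d}{dt}H_{\mathrm{smc}}(x(t))<0$ for almost every $t$ with $x(t)\ne0$, and $H_{\mathrm{smc}}(x(t))<H_{\mathrm{smc}}(x(s))$ whenever $s<t$ and $x(s)\ne0$. -/

import Mathlib

open Filter Topology MeasureTheory Matrix

noncomputable section

namespace PBSMC

/-! ### Clarke's generalized gradient -/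

section Clarke

variable {V : Type*} [NormedAddCommGroup V] [InnerProductSpace ℝ V]

/-- Clarke's generalized directional derivative
`f°(x; v) = limsup_{y → x, s ↓ 0} (f (y + s v) - f y) / s`
(only used for locally Lipschitz `f`, where the difference quotients are bounded). -/
def clarkeDeriv (f : V → ℝ) (x v : V) : ℝ :=
  limsup (fun p : V × ℝ => (f (p.1 + p.2 • v) - f p.1) / p.2) (𝓝 x ×ˢ 𝓝[>] (0 : ℝ))

/-- Clarke's generalized gradient `∂f(x) = {ξ | ⟪ξ, v⟫ ≤ f°(x; v) for all v}`.  For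
`f = ‖·‖₁` it is the set-valued signum, with value `[-1, 1]` in each vanishing component. -/
def clarkeGradient (f : V → ℝ) (x : V) : Set V :=
  {ξ | ∀ v, inner ℝ ξ v ≤ clarkeDeriv f x v}

/-- Clarke regularity: the one-sided directional derivatives exist and agree with `f°`.
All `C¹` and all convex functions on `ℝᵐ` are regular. -/
def ClarkeRegular (f : V → ℝ) : Prop :=
  ∀ x v, Tendsto (fun s : ℝ => (f (x + s • v) - f x) / s) (𝓝[>] 0) (𝓝 (clarkeDeriv f x v))

end Clarke

/-! ### Differential inclusions, stability, Lyapunov functions -/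

section Inclusion

variable {V : Type*} [NormedAddCommGroup V] [NormedSpace ℝ V]

/-- `x` is a (Filippov / Carathéodory) solution of `x' ∈ F x` on `[0, τ)`: it is locally absolutely
continuous there and satisfies the inclusion almost everywhere. -/
def IsSolution (F : V → Set V) (x : ℝ → V) (τ : EReal) : Prop :=
  (∀ b : ℝ, 0 < b → (b : EReal) < τ → AbsolutelyContinuousOnInterval x 0 b) ∧
  ∀ᵐ t : ℝ, 0 < t → (t : EReal) < τ → ∃ w ∈ F (x t), HasDerivAt x w t

/-- The origin is stable: from every initial state near the origin there is a solution on `[0, ∞)`,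
and every solution starting there can be continued to `[0, ∞)` and stays close to the origin. -/
def StableAtOrigin (F : V → Set V) : Prop :=
  ∀ r > 0, ∃ δ > 0, ∀ x₀ : V, ‖x₀‖ < δ →
    (∃ y : ℝ → V, y 0 = x₀ ∧ IsSolution F y ⊤) ∧
    ∀ (τ : EReal) (x : ℝ → V), x 0 = x₀ → IsSolution F x τ →
      (∃ y : ℝ → V, IsSolution F y ⊤ ∧ ∀ t : ℝ, 0 ≤ t → (t : EReal) < τ → y t = x t) ∧
      ∀ t : ℝ, 0 ≤ t → (t : EReal) < τ → ‖x t‖ < r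

/-- The origin is (locally, strongly) asymptotically stable: it is stable, and all solutions that
start close to it converge to it. -/
def AsymptoticallyStableAtOrigin (F : V → Set V) : Prop :=
  StableAtOrigin F ∧
  ∃ δ > 0, ∀ x : ℝ → V, IsSolution F x ⊤ → ‖x 0‖ < δ → Tendsto x atTop (𝓝 0)

/-- `W` is a strict Lyapunov function for the origin: in some ball around it, `W` is
continuous and positive definite, and along every solution inside the ball its time derivative is
negative (almost everywhere) and its value strictly decreases, as long as the origin is not
reached. -/
def IsStrictLyapunovFunction (F : V → Set V) (W : V → ℝ) : Prop :=
  W 0 = 0 ∧ ∃ r > 0, ContinuousOn W (Metric.ball 0 r) ∧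
    (∀ x ∈ Metric.ball (0 : V) r, x ≠ 0 → 0 < W x) ∧
    ∀ (τ : EReal) (x : ℝ → V), IsSolution F x τ →
      (∀ t : ℝ, 0 ≤ t → (t : EReal) < τ → x t ∈ Metric.ball 0 r) →
      (∀ᵐ t : ℝ, 0 < t → (t : EReal) < τ → x t ≠ 0 →
        ∃ d < 0, HasDerivAt (fun s => W (x s)) d t) ∧
      ∀ s t : ℝ, 0 ≤ s → s < t → (t : EReal) < τ → x s ≠ 0 → W (x t) < W (x s)

end Inclusion

/-! ### The mechanical port-Hamiltonian system in the coordinates `(q, η)` -/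

/-- `ℝᵐ` with the Euclidean norm. -/
abbrev Vec (m : ℕ) := EuclideanSpace ℝ (Fin m)

/-- Real `m × m` matrices. -/
abbrev Mat (m : ℕ) := Matrix (Fin m) (Fin m) ℝ

/-- The state space `ℝᵐ × ℝᵐ` of pairs `(q, η)` with the Euclidean norm of `ℝ²ᵐ`;
`x.fst = q` and `x.snd = η`. -/
abbrev State (m : ℕ) := WithLp 2 (Vec m × Vec m)

variable {m : ℕ}

/-- The matrix-vector product on `ℝᵐ`. -/
def act (A : Mat m) (v : Vec m) : Vec m := Matrix.toEuclideanCLM (𝕜 := ℝ) A v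

/-- The product of the block matrix `(A B; C D)` with the vector `z`. -/
def blockAct (A B C D : Mat m) (z : State m) : State m :=
  WithLp.toLp 2 (act A z.fst + act B z.snd, act C z.fst + act D z.snd)

/-- The data of a fully actuated mechanical port-Hamiltonian system after the change of momenta
`η = T(q)ᵀ p`: the inertia matrix `M`, a (necessarily nonsingular) factor `T` with `T Tᵀ = M⁻¹`, the
nonsingular input matrix `G₀` of the original system and the transformed damping-gyroscopic
matrix `D` with `D + Dᵀ ⪰ 0`. -/
structure MechanicalPH (m : ℕ) where
  M : Vec m → Mat m
  M_posDef : ∀ q, (M q).PosDef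
  T : Vec m → Mat m
  T_mul_transpose : ∀ q, T q * (T q)ᵀ = (M q)⁻¹
  T_continuous : Continuous T
  G₀ : Vec m → Mat m
  G₀_nonsingular : ∀ q, IsUnit (G₀ q)
  D : Vec m → Vec m → Mat m
  D_dissipative : ∀ q η, (D q η + (D q η)ᵀ).PosSemidef

/-- The input matrix `G(q) = T(q)ᵀ G₀(q)`. -/
def MechanicalPH.G (P : MechanicalPH m) (q : Vec m) : Mat m := (P.T q)ᵀ * P.G₀ q

/-- The Hamiltonian `H = ½‖η‖²` of the plant. -/
def kineticEnergy (x : State m) : ℝ := (1 / 2) * ‖x.snd‖ ^ 2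

/-- The right-hand side of the plant,
`(0 T; -Tᵀ -D) ∇H + (0; G) u`, at the state `x = (q, η)` and the input `u`. -/
def MechanicalPH.field (P : MechanicalPH m) (x : State m) (u : Vec m) : State m :=
  blockAct 0 (P.T x.fst) (-(P.T x.fst)ᵀ) (-P.D x.fst x.snd) (gradient kineticEnergy x) +
    WithLp.toLp 2 (0, act (P.G x.fst) u)

/-! ### The controller and the closed loop -/

/-- The Jacobian matrix `∂φ/∂q`. -/
def jacQ (φ : Vec m → Vec m → Vec m) (q η : Vec m) : Mat m :=
  (Matrix.toEuclideanCLM (n := Fin m) (𝕜 := ℝ)).symm (fderiv ℝ (fun q' => φ q' η) q)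

/-- The Jacobian matrix `∂φ/∂η`. -/
def jacEta (φ : Vec m → Vec m → Vec m) (q η : Vec m) : Mat m :=
  (Matrix.toEuclideanCLM (n := Fin m) (𝕜 := ℝ)).symm (fderiv ℝ (fun η' => φ q η') η)

/-- `Λ = ∂φ/∂q T (∂φ/∂η)ᵀ + ∂φ/∂η Tᵀ (∂φ/∂q)ᵀ`. -/
def MechanicalPH.Lam (P : MechanicalPH m) (φ : Vec m → Vec m → Vec m) (q η : Vec m) : Mat m :=
  jacQ φ q η * P.T q * (jacEta φ q η)ᵀ + jacEta φ q η * (P.T q)ᵀ * (jacQ φ q η)ᵀ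

/-- The feedback
`u = -G⁻¹ (∂φ/∂η)⁻¹ Λ ξ + G⁻¹ (D - (∂φ/∂η)⁻¹ (∂φ/∂q) T) η`,
where `ξ` is the value used for `∇U(σ)`. -/
def MechanicalPH.feedback (P : MechanicalPH m) (φ : Vec m → Vec m → Vec m)
    (x : State m) (ξ : Vec m) : Vec m :=
  -act ((P.G x.fst)⁻¹ * (jacEta φ x.fst x.snd)⁻¹ * P.Lam φ x.fst x.snd) ξ +
    act ((P.G x.fst)⁻¹ *
      (P.D x.fst x.snd - (jacEta φ x.fst x.snd)⁻¹ * jacQ φ x.fst x.snd * P.T x.fst)) x.snd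

/-- The closed-loop Hamiltonian `H_smc(q, η) = ½‖η‖² + U(φ(q, η))`. -/
def Hsmc (U : Vec m → ℝ) (φ : Vec m → Vec m → Vec m) (x : State m) : ℝ :=
  (1 / 2) * ‖x.snd‖ ^ 2 + U (φ x.fst x.snd)

/-- The closed-loop structure matrix
`(-T (∂φ/∂η)ᵀ (∂φ/∂q)⁻ᵀ, T; -Tᵀ, -(∂φ/∂η)⁻¹ (∂φ/∂q) T)` at `x`, applied to `z`. -/
def MechanicalPH.Jsmc (P : MechanicalPH m) (φ : Vec m → Vec m → Vec m)
    (x z : State m) : State m :=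
  blockAct
    (-(P.T x.fst * (jacEta φ x.fst x.snd)ᵀ * ((jacQ φ x.fst x.snd)⁻¹)ᵀ)) (P.T x.fst)
    (-(P.T x.fst)ᵀ) (-((jacEta φ x.fst x.snd)⁻¹ * jacQ φ x.fst x.snd * P.T x.fst)) z

/-- The closed-loop port-Hamiltonian system as a differential inclusion
`x' ∈ J_smc(x) ∂H_smc(x)`; where `H_smc` is `C¹` this is `x' = J_smc(x) ∇H_smc(x)`. -/
def MechanicalPH.closedLoop (P : MechanicalPH m) (U : Vec m → ℝ) (φ : Vec m → Vec m → Vec m)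
    (x : State m) : Set (State m) :=
  P.Jsmc φ x '' clarkeGradient (Hsmc U φ) x

/-- For each `i` the partial derivative `∂U/∂σᵢ` exists and is continuous on `{σᵢ ≠ 0}`: `U` may have
kinks, but only across the sub-sliding surfaces `σᵢ = 0` and only in the direction `σᵢ`. -/
def SmoothOffCoordinatePlanes (U : Vec m → ℝ) : Prop :=
  ∀ i : Fin m,
    (∀ σ : Vec m, σ i ≠ 0 → LineDifferentiableAt ℝ U σ (EuclideanSpace.single i 1)) ∧
    ContinuousOn (fun σ : Vec m => lineDeriv ℝ U σ (EuclideanSpace.single i 1)) {σ | σ i ≠ 0}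

/-- The standing regularity of a nonsmooth potential. -/
def AdmissiblePotential (U : Vec m → ℝ) : Prop :=
  LocallyLipschitz U ∧ (SmoothOffCoordinatePlanes U ∨ ClarkeRegular U)

end PBSMC

end

/-! Write `A`, `B` for the Jacobians of `φ` in `q`, `η`. Since `A` is invertible, `(q, η) ↦ σ` is a
submersion, so Clarke's chain rule for `H_smc` is an equality: the generalized gradients are exactly
`(Aᵀξ, η + Bᵀξ)` with `ξ ∈ ∂U(σ)` (`clarkeGradient_Hsmc`). Part (a) is then block algebra
(`field_feedback`).

For (b), the closed loop gives `σ' = -Λξ`. To conclude `(U ∘ σ)' = -⟪ξ, Λξ⟫` for this particular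
`ξ`, a nonsmooth chain rule is needed (`AdmissiblePotential.ae_hasDerivAt_comp`). At almost every
time each vanishing `σᵢ` has vanishing derivative, so the velocity `v` is tangent to the coordinate
planes through `σ`; in the directions `±v` the one-sided derivatives of `U` equal `U°`, and
differentiability of `U ∘ σ` squeezes `⟪ξ, v⟫` between equal bounds.

Writing `η + Bᵀξ = Bᵀp`, the quadratic form of `J_smc` yields `H_smc' = -½⟪ξ, Λξ⟫ - ½⟪p, Λp⟫`
(`ae_dissipation`). The gradient inequality on `U` turns the first balance into `u' ≤ -εc²u^(2ρ)`
for `u = U ∘ σ`, which dies in finite time as `2ρ < 1`. The second vanishes only if `ξ = p = 0`,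
hence `η = 0` and `σ = 0`, which near the origin forces `q = 0`. Once `σ = 0`, the balance for `U ∘
σ` forces `ξ = 0` and `H_smc = ½‖η‖²` decays at a rate proportional to itself.

Existence comes from Euler polygons of an arbitrary selection (`exists_euler_limit`). Their limit
velocities stay in the values because `U°` is upper semicontinuous and `J_smc` is continuous and
invertible, its symmetric part being negative definite (`mem_clarkeField_of_forall`). Confinement in
sublevel sets of `H_smc` makes solutions global. -/

namespace PBSMC

/-! ### Calculus of Clarke's directional derivative and gradient -/

section ClarkeCalculus

variable {V : Type*} [NormedAddCommGroup V] [InnerProductSpace ℝ V] {f : V → ℝ} {x v : V}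

theorem tendsto_snd_nhds_zero {E : Type*} [TopologicalSpace E] (x : E) :
    Tendsto (fun p : E × ℝ => p.2) (𝓝 x ×ˢ 𝓝[>] (0 : ℝ)) (𝓝 0) :=
  tendsto_nhds_of_tendsto_nhdsWithin (s := Set.Ioi 0) tendsto_snd

/-- Difference quotients of a locally Lipschitz function along two families of directions with the
same limit are asymptotically equal. -/
theorem tendsto_quotient_sub_quotient {α : Type*} {l : Filter α} (hf : LocallyLipschitz f)
    {y w w' : α → V} {s : α → ℝ} (hy : Tendsto y l (𝓝 x)) (hs : Tendsto s l (𝓝[>] 0))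
    (hw : Tendsto w l (𝓝 v)) (hw' : Tendsto w' l (𝓝 v)) :
    Tendsto (fun a => (f (y a + s a • w a) - f (y a)) / s a -
      (f (y a + s a • w' a) - f (y a)) / s a) l (𝓝 0) := by
  obtain ⟨K, t, ht, hK⟩ := hf x
  have hs0 : Tendsto s l (𝓝 0) := tendsto_nhds_of_tendsto_nhdsWithin hs
  have hpos : ∀ᶠ a in l, 0 < s a := hs.eventually self_mem_nhdsWithin
  have h1 : Tendsto (fun a => y a + s a • w a) l (𝓝 x) := by
    simpa using hy.add (hs0.smul hw)
  have h2 : Tendsto (fun a => y a + s a • w' a) l (𝓝 x) := by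
    simpa using hy.add (hs0.smul hw')
  have h3 : Tendsto (fun a => (K : ℝ) * ‖w a - w' a‖) l (𝓝 0) := by
    simpa using ((hw.sub hw').norm).const_mul (K : ℝ)
  refine squeeze_zero_norm' ?_ h3
  filter_upwards [h1.eventually ht, h2.eventually ht, hpos] with a ha hb hp
  have := hK.dist_le_mul _ ha _ hb
  rw [dist_eq_norm, dist_eq_norm] at this
  have e : (y a + s a • w a) - (y a + s a • w' a) = s a • (w a - w' a) := by
    rw [smul_sub]; abel
  rw [e, norm_smul, Real.norm_of_nonneg hp.le] at this
  rw [← sub_div, norm_div, Real.norm_of_nonneg hp.le, div_le_iff₀ hp]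
  calc _ = ‖f (y a + s a • w a) - f (y a + s a • w' a)‖ := by congr 1; ring
    _ ≤ _ := this
    _ = _ := by ring

theorem eventually_abs_quotient_le {K : NNReal} {t : Set V} (ht : t ∈ 𝓝 x)
    (hK : LipschitzOnWith K f t) (v : V) :
    ∀ᶠ p : V × ℝ in 𝓝 x ×ˢ 𝓝[>] (0 : ℝ), |(f (p.1 + p.2 • v) - f p.1) / p.2| ≤ K * ‖v‖ := by
  have hs : Tendsto (fun p : V × ℝ => p.2) (𝓝 x ×ˢ 𝓝[>] (0 : ℝ)) (𝓝[>] 0) := tendsto_snd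
  have hs0 : Tendsto (fun p : V × ℝ => p.2) (𝓝 x ×ˢ 𝓝[>] (0 : ℝ)) (𝓝 0) :=
    tendsto_nhds_of_tendsto_nhdsWithin hs
  have hy : Tendsto (fun p : V × ℝ => p.1) (𝓝 x ×ˢ 𝓝[>] (0 : ℝ)) (𝓝 x) := tendsto_fst
  have h1 : Tendsto (fun p : V × ℝ => p.1 + p.2 • v) (𝓝 x ×ˢ 𝓝[>] (0 : ℝ)) (𝓝 x) := by
    simpa using hy.add (hs0.smul_const v)
  filter_upwards [hy.eventually ht, h1.eventually ht, hs.eventually self_mem_nhdsWithin]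
    with p ha hb hp
  have hp' : 0 < p.2 := hp
  have := hK.dist_le_mul _ hb _ ha
  rw [dist_eq_norm, dist_eq_norm, add_sub_cancel_left, norm_smul, Real.norm_of_nonneg hp'.le] at this
  rw [abs_div, abs_of_pos hp', div_le_iff₀ hp']
  calc _ ≤ _ := this
    _ = _ := by ring

theorem isBoundedUnder_le_quotient (hf : LocallyLipschitz f) (x v : V) :
    IsBoundedUnder (· ≤ ·) (𝓝 x ×ˢ 𝓝[>] (0 : ℝ))
      (fun p : V × ℝ => (f (p.1 + p.2 • v) - f p.1) / p.2) := by
  obtain ⟨K, t, ht, hK⟩ := hf x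
  exact isBoundedUnder_of_eventually_le
    ((eventually_abs_quotient_le ht hK v).mono fun _ hp => (abs_le.1 hp).2)

theorem isBoundedUnder_ge_quotient (hf : LocallyLipschitz f) (x v : V) :
    IsBoundedUnder (· ≥ ·) (𝓝 x ×ˢ 𝓝[>] (0 : ℝ))
      (fun p : V × ℝ => (f (p.1 + p.2 • v) - f p.1) / p.2) := by
  obtain ⟨K, t, ht, hK⟩ := hf x
  exact isBoundedUnder_of_eventually_ge
    ((eventually_abs_quotient_le ht hK v).mono fun _ hp => (abs_le.1 hp).1)

/-- If `f°(x; v) < c`, all difference quotients near `x` in directions near `v` are below `c`. -/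
theorem eventually_quotient_lt {α : Type*} {l : Filter α} (hf : LocallyLipschitz f) {c : ℝ}
    (hc : clarkeDeriv f x v < c) {y w : α → V} {s : α → ℝ} (hy : Tendsto y l (𝓝 x))
    (hs : Tendsto s l (𝓝[>] 0)) (hw : Tendsto w l (𝓝 v)) :
    ∀ᶠ a in l, (f (y a + s a • w a) - f (y a)) / s a < c := by
  obtain ⟨c', h1, h2⟩ := exists_between hc
  have hlt := eventually_lt_of_limsup_lt h1 (isBoundedUnder_le_quotient hf x v)
  have hlt' := (hy.prodMk hs).eventually hlt
  have hd := tendsto_quotient_sub_quotient hf hy hs hw (tendsto_const_nhds (x := v))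
  filter_upwards [hlt', hd.eventually (gt_mem_nhds (sub_pos.2 h2))] with a ha hb
  linarith

theorem clarkeDeriv_le (hf : LocallyLipschitz f) {c : ℝ}
    (h : ∀ᶠ p : V × ℝ in 𝓝 x ×ˢ 𝓝[>] (0 : ℝ), (f (p.1 + p.2 • v) - f p.1) / p.2 ≤ c) :
    clarkeDeriv f x v ≤ c :=
  limsup_le_of_le (isBoundedUnder_ge_quotient hf x v).isCoboundedUnder_le h

theorem clarkeDeriv_eq_of_tendsto {L : ℝ}
    (h : Tendsto (fun p : V × ℝ => (f (p.1 + p.2 • v) - f p.1) / p.2) (𝓝 x ×ˢ 𝓝[>] (0 : ℝ)) (𝓝 L)) :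
    clarkeDeriv f x v = L := h.limsup_eq

theorem clarkeDeriv_le_mul_norm (hf : LocallyLipschitz f) {K : NNReal} {t : Set V} (ht : t ∈ 𝓝 x)
    (hK : LipschitzOnWith K f t) (v : V) : clarkeDeriv f x v ≤ K * ‖v‖ :=
  clarkeDeriv_le hf ((eventually_abs_quotient_le ht hK v).mono fun _ hp => (abs_le.1 hp).2)

theorem clarkeDeriv_zero_right (f : V → ℝ) (x : V) : clarkeDeriv f x 0 = 0 :=
  clarkeDeriv_eq_of_tendsto (by simp)

/-- Clarke's directional derivative is jointly upper semicontinuous. -/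
theorem eventually_clarkeDeriv_le (hf : LocallyLipschitz f) {c : ℝ} (hc : clarkeDeriv f x v < c) :
    ∀ᶠ z : V × V in 𝓝 (x, v), clarkeDeriv f z.1 z.2 ≤ c := by
  have h := eventually_quotient_lt (l := 𝓝 (x, v) ×ˢ 𝓝[>] (0 : ℝ)) hf hc
    (y := fun a => a.1.1) (w := fun a => a.1.2) (s := fun a => a.2)
    ((continuous_fst.tendsto (x, v)).comp tendsto_fst) tendsto_snd
    ((continuous_snd.tendsto (x, v)).comp tendsto_fst)
  obtain ⟨pa, hpa, pb, hpb, H⟩ := eventually_prod_iff.1 h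
  -- A bound valid near `(x, v)` for small steps is also valid near every point close to `(x, v)`,
  -- with the same threshold on the step.
  filter_upwards [eventually_eventually_nhds.2 hpa] with z hz
  refine clarkeDeriv_le hf ?_
  have hz' : ∀ᶠ y in 𝓝 z.1, pa (y, z.2) :=
    (Continuous.prodMk_left z.2).tendsto z.1 |>.eventually hz
  filter_upwards [hz'.prod_mk hpb] with p hp
  exact (H hp.1 hp.2).le

/-- Rescaling the step: the quotient in direction `c • v` with step `s` is `c` times the quotient in
direction `v` with step `s * c`. Applying this to `c⁻¹` as well gives equality. -/
theorem clarkeDeriv_smul_le (hf : LocallyLipschitz f) {c : ℝ} (hc : 0 < c) (x v : V) :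
    clarkeDeriv f x (c • v) ≤ c * clarkeDeriv f x v := by
  refine le_of_forall_gt_imp_ge_of_dense fun d hd => ?_
  have hd' : clarkeDeriv f x v < d / c := by rwa [lt_div_iff₀' hc]
  refine clarkeDeriv_le hf ?_
  have hs : Tendsto (fun p : V × ℝ => p.2 * c) (𝓝 x ×ˢ 𝓝[>] (0 : ℝ)) (𝓝[>] 0) := by
    refine tendsto_nhdsWithin_iff.2 ⟨?_, ?_⟩
    · simpa using (tendsto_snd_nhds_zero x).mul_const c
    · filter_upwards [tendsto_snd.eventually self_mem_nhdsWithin] with p hp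
      exact mul_pos hp hc
  filter_upwards [eventually_quotient_lt hf hd' tendsto_fst hs (tendsto_const_nhds (x := v)),
    tendsto_snd.eventually self_mem_nhdsWithin] with p hp hp2
  have hp2' : 0 < p.2 := hp2
  rw [smul_smul]
  rw [div_lt_div_iff₀ (by positivity) hc] at hp
  rw [div_le_iff₀ hp2']
  have : (f (p.1 + (p.2 * c) • v) - f p.1) * c < (d * p.2) * c := by linarith
  exact (lt_of_mul_lt_mul_right this hc.le).le

theorem clarkeDeriv_smul (hf : LocallyLipschitz f) {c : ℝ} (hc : 0 < c) (x v : V) :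
    clarkeDeriv f x (c • v) = c * clarkeDeriv f x v := by
  refine le_antisymm (clarkeDeriv_smul_le hf hc x v) ?_
  have := clarkeDeriv_smul_le hf (inv_pos.2 hc) x (c • v)
  rw [smul_smul, inv_mul_cancel₀ hc.ne', one_smul] at this
  rwa [← le_inv_mul_iff₀ hc]

/-- The increment splits at the intermediate point `y + s • w`. That point also tends to `x`, and
the limsup ranges over moving base points, so both pieces are controlled. -/
theorem clarkeDeriv_add_le (hf : LocallyLipschitz f) (x v w : V) :
    clarkeDeriv f x (v + w) ≤ clarkeDeriv f x v + clarkeDeriv f x w := by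
  refine le_of_forall_pos_le_add fun ε hε => ?_
  refine clarkeDeriv_le hf ?_
  have h1 := eventually_quotient_lt (l := 𝓝 x ×ˢ 𝓝[>] (0 : ℝ)) (c := clarkeDeriv f x w + ε / 2) hf
    (by linarith) tendsto_fst tendsto_snd (tendsto_const_nhds (x := w))
  have hy : Tendsto (fun p : V × ℝ => p.1 + p.2 • w) (𝓝 x ×ˢ 𝓝[>] (0 : ℝ)) (𝓝 x) := by
    simpa using tendsto_fst.add ((tendsto_snd_nhds_zero x).smul_const w)
  have h2 := eventually_quotient_lt (l := 𝓝 x ×ˢ 𝓝[>] (0 : ℝ)) (c := clarkeDeriv f x v + ε / 2) hf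
    (by linarith) hy tendsto_snd (tendsto_const_nhds (x := v))
  filter_upwards [h1, h2] with p hp1 hp2
  have e : p.1 + p.2 • (v + w) = p.1 + p.2 • w + p.2 • v := by rw [smul_add]; abel
  have : (f (p.1 + p.2 • (v + w)) - f p.1) / p.2 =
      (f (p.1 + p.2 • w + p.2 • v) - f (p.1 + p.2 • w)) / p.2 +
      (f (p.1 + p.2 • w) - f p.1) / p.2 := by rw [e]; ring
  linarith

/-- Hahn–Banach: `f°(x; ·)` is sublinear, so the functional on the zero subspace extends to a linear
one below it, which Riesz represents by a vector. -/
theorem clarkeGradient_nonempty [FiniteDimensional ℝ V] (hf : LocallyLipschitz f) (x : V) :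
    (clarkeGradient f x).Nonempty := by
  obtain ⟨g, -, hg⟩ := exists_extension_of_le_sublinear (⊥ : V →ₗ.[ℝ] ℝ) (clarkeDeriv f x)
    (fun c hc v => clarkeDeriv_smul hf hc x v) (clarkeDeriv_add_le hf x) (by
      rintro ⟨y, hy⟩
      have hy0 : y = 0 := (Submodule.mem_bot ℝ).1 hy
      subst hy0
      rw [clarkeDeriv_zero_right]
      exact le_of_eq (LinearPMap.map_zero _))
  refine ⟨(InnerProductSpace.toDual ℝ V).symm (LinearMap.toContinuousLinearMap g), fun v => ?_⟩
  simpa using hg v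

theorem norm_le_of_mem_clarkeGradient (hf : LocallyLipschitz f) {K : NNReal} {t : Set V}
    (ht : t ∈ 𝓝 x) (hK : LipschitzOnWith K f t) {ξ : V} (hξ : ξ ∈ clarkeGradient f x) :
    ‖ξ‖ ≤ K := by
  have h := (hξ ξ).trans (clarkeDeriv_le_mul_norm hf ht hK ξ)
  rw [real_inner_self_eq_norm_sq] at h
  by_contra! hlt
  have : 0 < ‖ξ‖ := K.coe_nonneg.trans_lt hlt
  nlinarith

/-- Strict differentiability is what lets the base point move together with the step. -/
theorem tendsto_quotient_of_hasStrictFDerivAt {E F : Type*} [NormedAddCommGroup E]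
    [InnerProductSpace ℝ E] [NormedAddCommGroup F] [NormedSpace ℝ F] {h : E → F} {h' : E →L[ℝ] F}
    {z : E} (hh : HasStrictFDerivAt h h' z) (u : E) :
    Tendsto (fun p : E × ℝ => p.2⁻¹ • (h (p.1 + p.2 • u) - h p.1))
      (𝓝 z ×ˢ 𝓝[>] (0 : ℝ)) (𝓝 (h' u)) := by
  have hs0 : Tendsto (fun p : E × ℝ => p.2) (𝓝 z ×ˢ 𝓝[>] (0 : ℝ)) (𝓝 0) :=
    tendsto_nhds_of_tendsto_nhdsWithin tendsto_snd
  have ht : Tendsto (fun p : E × ℝ => (p.1 + p.2 • u, p.1)) (𝓝 z ×ˢ 𝓝[>] (0 : ℝ))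
      (𝓝 (z, z)) := by
    have : Tendsto (fun p : E × ℝ => p.1 + p.2 • u) (𝓝 z ×ˢ 𝓝[>] (0 : ℝ)) (𝓝 z) := by
      simpa using tendsto_fst.add (hs0.smul_const u)
    exact this.prodMk_nhds tendsto_fst
  have ho := hh.isLittleO.comp_tendsto ht
  have hO : (fun p : E × ℝ => (p.1 + p.2 • u) - p.1) =O[𝓝 z ×ˢ 𝓝[>] (0 : ℝ)]
      (fun p : E × ℝ => p.2) := by
    refine Asymptotics.IsBigO.of_bound ‖u‖ (Eventually.of_forall fun p => ?_)
    rw [add_sub_cancel_left, norm_smul, mul_comm]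
  have ho' := (ho.trans_isBigO hO)
  have := (Asymptotics.isLittleO_iff_tendsto' (f := fun p : E × ℝ =>
    ‖h (p.1 + p.2 • u) - h p.1 - h' (p.1 + p.2 • u - p.1)‖) (g := fun p : E × ℝ => p.2) ?_).1
      ho'.norm_left
  · rw [tendsto_iff_norm_sub_tendsto_zero]
    refine this.congr' ?_
    filter_upwards [tendsto_snd.eventually self_mem_nhdsWithin] with p hp
    have hp' : 0 < p.2 := hp
    have e : p.2⁻¹ • (h (p.1 + p.2 • u) - h p.1) - h' u =
        p.2⁻¹ • (h (p.1 + p.2 • u) - h p.1 - h' (p.1 + p.2 • u - p.1)) := by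
      rw [add_sub_cancel_left, map_smul, smul_sub _ _ (p.2 • h' u), smul_smul,
        inv_mul_cancel₀ hp'.ne', one_smul]
    rw [e, norm_smul, norm_inv, Real.norm_of_nonneg hp'.le, div_eq_inv_mul]
  · filter_upwards [tendsto_snd.eventually self_mem_nhdsWithin] with p hp h0
    exact absurd h0 (ne_of_gt hp)

theorem limsup_eq_add_of_tendsto_sub {α : Type*} {l : Filter α} [l.NeBot] {a b : α → ℝ} {L : ℝ}
    (h : Tendsto (fun p => a p - b p) l (𝓝 L)) (hle : IsBoundedUnder (· ≤ ·) l b)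
    (hge : IsBoundedUnder (· ≥ ·) l b) : limsup a l = L + limsup b l := by
  have hlim : limsup a l = limsup ((fun p => a p - b p) + b) l := by
    congr 1; ext p; simp
  have h0 := h.isBoundedUnder_le
  have h1 := h.isBoundedUnder_ge
  rw [hlim]
  refine le_antisymm ?_ ?_
  · rw [← h.limsup_eq]
    exact limsup_add_le h1 h0 hge.isCoboundedUnder_le hle
  · rw [← h.liminf_eq]
    rw [add_comm, add_comm (fun p => a p - b p)]
    exact le_limsup_add hle hge.isCoboundedUnder_le h0 h1

/-- Chain rule for Clarke's directional derivative under a smooth submersion, with a smooth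
summand. -/
theorem clarkeDeriv_add_comp {E : Type*} [NormedAddCommGroup E] [InnerProductSpace ℝ E]
    [CompleteSpace E] [CompleteSpace V] {k : E → ℝ} {g : E → V} {k' : E →L[ℝ] ℝ} {g' : E →L[ℝ] V}
    {z : E} (hf : LocallyLipschitz f) (hk : HasStrictFDerivAt k k' z)
    (hg : HasStrictFDerivAt g g' z) (hsurj : Function.Surjective g') (u : E) :
    clarkeDeriv (fun y => k y + f (g y)) z u = k' u + clarkeDeriv f (g z) (g' u) := by
  have hk1 := tendsto_quotient_of_hasStrictFDerivAt hk u
  have hg1 := tendsto_quotient_of_hasStrictFDerivAt hg u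
  have hgc : Tendsto (fun p : E × ℝ => g p.1) (𝓝 z ×ˢ 𝓝[>] (0 : ℝ)) (𝓝 (g z)) :=
    hg.continuousAt.tendsto.comp tendsto_fst
  have hd := tendsto_quotient_sub_quotient hf hgc tendsto_snd hg1 (tendsto_const_nhds (x := g' u))
  have hsum : Tendsto (fun p : E × ℝ =>
      ((k (p.1 + p.2 • u) + f (g (p.1 + p.2 • u))) - (k p.1 + f (g p.1))) / p.2 -
        (f (g p.1 + p.2 • g' u) - f (g p.1)) / p.2) (𝓝 z ×ˢ 𝓝[>] (0 : ℝ)) (𝓝 (k' u)) := by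
    have := hk1.add hd
    rw [add_zero] at this
    refine this.congr' ?_
    filter_upwards [tendsto_snd.eventually self_mem_nhdsWithin] with p hp
    have hp' : p.2 ≠ 0 := ne_of_gt hp
    rw [smul_smul, mul_inv_cancel₀ hp', one_smul, add_sub_cancel, smul_eq_mul]
    field_simp
    ring
  -- A submersion is open, so it carries the neighbourhood filter of `z` onto that of `g z`; thus
  -- the limsup along `g` equals the full limsup defining `f°`. This is where surjectivity gives an
  -- equality.
  have hmap : Filter.map (fun p : E × ℝ => (g p.1, p.2)) (𝓝 z ×ˢ 𝓝[>] (0 : ℝ)) =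
      𝓝 (g z) ×ˢ 𝓝[>] (0 : ℝ) := by
    have h1 := hg.map_nhds_eq_of_surj (LinearMap.range_eq_top.2 hsurj)
    have := Filter.prod_map_map_eq (f₁ := 𝓝 z) (f₂ := 𝓝[>] (0 : ℝ)) (m₁ := g) (m₂ := id)
    rw [h1, Filter.map_id] at this
    exact this.symm
  have hlim : clarkeDeriv f (g z) (g' u) = limsup (fun p : E × ℝ =>
      (f (g p.1 + p.2 • g' u) - f (g p.1)) / p.2) (𝓝 z ×ˢ 𝓝[>] (0 : ℝ)) := by
    rw [clarkeDeriv, ← hmap]; rfl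
  have hble : IsBoundedUnder (· ≤ ·) (𝓝 z ×ˢ 𝓝[>] (0 : ℝ)) (fun p : E × ℝ =>
      (f (g p.1 + p.2 • g' u) - f (g p.1)) / p.2) := by
    have := isBoundedUnder_le_quotient hf (g z) (g' u)
    rw [← hmap] at this
    exact this
  have hbge : IsBoundedUnder (· ≥ ·) (𝓝 z ×ˢ 𝓝[>] (0 : ℝ)) (fun p : E × ℝ =>
      (f (g p.1 + p.2 • g' u) - f (g p.1)) / p.2) := by
    have := isBoundedUnder_ge_quotient hf (g z) (g' u)
    rw [← hmap] at this
    exact this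
  rw [hlim, clarkeDeriv]
  exact limsup_eq_add_of_tendsto_sub hsum hble hbge

end ClarkeCalculus

/-! ### Absolutely continuous curves, monotonicity and finite-time extinction -/

section AbsolutelyContinuous

theorem _root_.LipschitzOnWith.comp_absolutelyContinuousOnInterval {X Y : Type*}
    [PseudoMetricSpace X] [PseudoMetricSpace Y] {g : X → Y} {K : NNReal} {s : Set X}
    (hg : LipschitzOnWith K g s) {x : ℝ → X} {a b : ℝ}
    (hx : AbsolutelyContinuousOnInterval x a b) (hs : ∀ t ∈ Set.uIcc a b, x t ∈ s) :
    AbsolutelyContinuousOnInterval (fun t => g (x t)) a b := by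
  have hx' : Tendsto (fun E : ℕ × (ℕ → ℝ × ℝ) => (K : ℝ) *
      ∑ i ∈ Finset.range E.1, dist (x (E.2 i).1) (x (E.2 i).2))
      (AbsolutelyContinuousOnInterval.totalLengthFilter ⊓
        𝓟 (AbsolutelyContinuousOnInterval.disjWithin a b)) (𝓝 0) := by
    simpa using Tendsto.const_mul (K : ℝ) hx
  refine squeeze_zero' (Eventually.of_forall fun E => Finset.sum_nonneg fun i _ => dist_nonneg) ?_ hx'
  refine Filter.Eventually.filter_mono inf_le_right ?_
  rw [eventually_principal]
  intro E hE
  rw [Finset.mul_sum]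
  exact Finset.sum_le_sum fun i hi =>
    hg.dist_le_mul _ (hs _ (hE.1 i hi).1) _ (hs _ (hE.1 i hi).2)

theorem _root_.LocallyLipschitz.comp_absolutelyContinuousOnInterval {X Y : Type*}
    [SeminormedAddCommGroup X] [PseudoMetricSpace Y] {g : X → Y} (hg : LocallyLipschitz g)
    {x : ℝ → X} {a b : ℝ} (hx : AbsolutelyContinuousOnInterval x a b) :
    AbsolutelyContinuousOnInterval (fun t => g (x t)) a b := by
  have hc : IsCompact (x '' Set.uIcc a b) := isCompact_uIcc.image_of_continuousOn hx.continuousOn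
  obtain ⟨K, hK⟩ := LocallyLipschitzOn.exists_lipschitzOnWith_of_compact hc hg.locallyLipschitzOn
  exact hK.comp_absolutelyContinuousOnInterval hx fun t ht => Set.mem_image_of_mem x ht

variable {g : ℝ → ℝ} {a b c : ℝ}

theorem _root_.AbsolutelyContinuousOnInterval.sub_le_of_ae_deriv_le
    (hg : AbsolutelyContinuousOnInterval g a b) (hab : a ≤ b)
    (h : ∀ᵐ t : ℝ, t ∈ Set.Ioo a b → ∃ d ≤ c, HasDerivAt g d t) : g b - g a ≤ c * (b - a) := by
  rw [← hg.integral_deriv_eq_sub]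
  have : ∫ _t in a..b, c = c * (b - a) := by simp [mul_comm]
  rw [← this]
  refine intervalIntegral.integral_mono_ae_restrict hab hg.intervalIntegrable_deriv (by simp) ?_
  rw [EventuallyLE, ← restrict_Ioo_eq_restrict_Icc, ae_restrict_iff' measurableSet_Ioo]
  filter_upwards [h] with t ht htm
  obtain ⟨d, hd, hdd⟩ := ht htm
  rwa [hdd.deriv]

theorem _root_.AbsolutelyContinuousOnInterval.le_of_ae_deriv_nonpos
    (hg : AbsolutelyContinuousOnInterval g a b) (hab : a ≤ b)
    (h : ∀ᵐ t : ℝ, t ∈ Set.Ioo a b → ∃ d ≤ 0, HasDerivAt g d t) : g b ≤ g a := by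
  have := hg.sub_le_of_ae_deriv_le hab h
  linarith

theorem _root_.AbsolutelyContinuousOnInterval.lt_of_ae_deriv_neg
    (hg : AbsolutelyContinuousOnInterval g a b) (hab : a < b)
    (h : ∀ᵐ t : ℝ, t ∈ Set.Ioo a b → ∃ d < 0, HasDerivAt g d t) : g b < g a := by
  have hle : ∀ᵐ t ∂(volume.restrict (Set.Ioc a b)), deriv g t < 0 := by
    rw [← restrict_Ioo_eq_restrict_Ioc, ae_restrict_iff' measurableSet_Ioo]
    filter_upwards [h] with t ht htm
    obtain ⟨d, hd, hdd⟩ := ht htm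
    rwa [hdd.deriv]
  have hi := hg.intervalIntegrable_deriv
  have hpos : 0 < ∫ t in a..b, -deriv g t := by
    rw [intervalIntegral.integral_pos_iff_support_of_nonneg_ae' (f := fun t => -deriv g t) _ hi.neg]
    · refine ⟨hab, ?_⟩
      have hae : ∀ᵐ t ∂(volume.restrict (Set.Ioc a b)), t ∈ Function.support (fun t => -deriv g t) := by
        filter_upwards [hle] with t ht
        simp [ht.ne]
      rw [pos_iff_ne_zero]
      intro h0
      have h1 : volume.restrict (Set.Ioc a b) (Function.support fun t => -deriv g t) = 0 := by
        rw [Measure.restrict_apply₀']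
        · exact h0
        · exact measurableSet_Ioc.nullMeasurableSet
      have h2 : volume.restrict (Set.Ioc a b) Set.univ = 0 := by
        have : ∀ᵐ t ∂(volume.restrict (Set.Ioc a b)), False := by
          have h3 : ∀ᵐ t ∂(volume.restrict (Set.Ioc a b)),
            t ∉ Function.support fun t => -deriv g t := measure_eq_zero_iff_ae_notMem.1 h1
          filter_upwards [hae, h3] with t ht ht' using ht' ht
        rw [ae_iff] at this
        simpa using this
      rw [Measure.restrict_apply_univ, Real.volume_Ioc, ENNReal.ofReal_eq_zero] at h2
      linarith
    · rw [Set.uIoc_of_le hab.le]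
      filter_upwards [hle] with t ht
      simpa using ht.le
  rw [intervalIntegral.integral_neg, hg.integral_deriv_eq_sub] at hpos
  linarith

/-- A property that holds a.e. on each `[0, b]`, `b < τ`, holds a.e. on `(0, τ)`. -/
theorem ae_of_forall_lt {p : ℝ → Prop} {τ : EReal}
    (h : ∀ b : ℝ, 0 < b → (b : EReal) < τ → ∀ᵐ t : ℝ, t ∈ Set.Ioo 0 b → p t) :
    ∀ᵐ t : ℝ, 0 < t → (t : EReal) < τ → p t := by
  -- Rational endpoints exhaust the interval, so only countably many null sets are discarded.
  have h' : ∀ᵐ t : ℝ, ∀ q : ℚ, 0 < (q : ℝ) → ((q : ℝ) : EReal) < τ → t ∈ Set.Ioo 0 (q : ℝ) → p t := by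
    rw [ae_all_iff]
    intro q
    by_cases hq : 0 < (q : ℝ) ∧ ((q : ℝ) : EReal) < τ
    · filter_upwards [h q hq.1 hq.2] with t ht _ _ using ht
    · exact Eventually.of_forall fun t h1 h2 => absurd ⟨h1, h2⟩ hq
  filter_upwards [h'] with t ht h0 hτ
  obtain ⟨q, hq1, hq2⟩ := EReal.lt_iff_exists_rat_btwn.1 hτ
  have : t < (q : ℝ) := by exact_mod_cast hq1
  exact ht q (h0.trans this) hq2 ⟨h0, this⟩

/-- Pairing the curve with its own increment `u = x t - x s` reduces the claim to the scalar
fundamental theorem: `‖u‖² ≤ ‖u‖ L (t - s)`. -/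
theorem _root_.AbsolutelyContinuousOnInterval.lipschitzOnWith_of_ae_norm_deriv_le {V : Type*}
    [NormedAddCommGroup V] [InnerProductSpace ℝ V] {x : ℝ → V} {L : NNReal}
    (hx : AbsolutelyContinuousOnInterval x a b)
    (h : ∀ᵐ t : ℝ, t ∈ Set.Ioo a b → ∃ w, ‖w‖ ≤ L ∧ HasDerivAt x w t) :
    LipschitzOnWith L x (Set.Icc a b) := by
  have key : ∀ s ∈ Set.Icc a b, ∀ t ∈ Set.Icc a b, s ≤ t → ‖x t - x s‖ ≤ L * (t - s) := by
    intro s hs t ht hst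
    set u := x t - x s with hu
    have hlip : LipschitzWith ‖innerSL ℝ u‖₊ (innerSL ℝ u) := (innerSL ℝ u).lipschitz
    have hac : AbsolutelyContinuousOnInterval (fun r => innerSL ℝ u (x r)) s t :=
      (hlip.lipschitzOnWith (s := Set.univ)).comp_absolutelyContinuousOnInterval
        (hx.mono (by
          rw [Set.uIcc_of_le hst, Set.uIcc_of_le (hs.1.trans hs.2)]
          exact Set.Icc_subset_Icc hs.1 ht.2)) fun _ _ => Set.mem_univ _
    have := hac.sub_le_of_ae_deriv_le (c := ‖u‖ * L) hst (by
      filter_upwards [h] with r hr hrm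
      obtain ⟨w, hw, hd⟩ := hr ⟨hs.1.trans_lt hrm.1, hrm.2.trans_le ht.2⟩
      refine ⟨innerSL ℝ u w, ?_, (innerSL ℝ u).hasFDerivAt.comp_hasDerivAt r hd⟩
      exact (real_inner_le_norm u w).trans (by gcongr))
    simp only [innerSL_apply_apply] at this
    rw [← inner_sub_right, ← hu, real_inner_self_eq_norm_sq] at this
    by_contra! hlt
    have h0 : 0 ≤ L * (t - s) := mul_nonneg L.coe_nonneg (by linarith)
    nlinarith
  refine LipschitzOnWith.of_dist_le_mul fun s hs t ht => ?_
  rcases le_total s t with hst | hst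
  · rw [dist_comm, dist_eq_norm, dist_comm, Real.dist_eq, abs_of_nonneg (by linarith)]
    exact key s hs t ht hst
  · rw [dist_eq_norm, Real.dist_eq, abs_of_nonneg (by linarith)]
    exact key t ht s hs hst

/-- At almost every zero of an absolutely continuous function its derivative vanishes. -/
theorem _root_.AbsolutelyContinuousOnInterval.ae_hasDerivAt_zero_of_eq_zero
    (hg : AbsolutelyContinuousOnInterval g a b) :
    ∀ᵐ t : ℝ, t ∈ Set.Ioo a b → g t = 0 → HasDerivAt g 0 t := by
  have habs : AbsolutelyContinuousOnInterval (fun t => |g t|) a b :=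
    ((lipschitzWith_one_norm (E := ℝ)).lipschitzOnWith (s := Set.univ)).comp_absolutelyContinuousOnInterval
      hg fun _ _ => Set.mem_univ _
  filter_upwards [habs.ae_differentiableAt] with t ht htm h0
  have hd := (ht (Set.Icc_subset_uIcc ⟨htm.1.le, htm.2.le⟩)).hasDerivAt
  -- A zero of `g` minimizes `|g|`, so where `|g|` is differentiable its derivative is zero; `g` has
  -- increments of the same size there.
  have hmin : IsLocalMin (fun t => |g t|) t := Eventually.of_forall fun s => by simp [h0]
  rw [hmin.hasDerivAt_eq_zero hd] at hd
  rw [hasDerivAt_iff_isLittleO] at hd ⊢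
  refine Asymptotics.IsLittleO.of_norm_left (hd.norm_left.congr_left fun s => ?_)
  simp [h0]

/-- Finite-time extinction for `V' ≤ -k V ^ (2 ρ)`, `ρ < 1/2`. -/
theorem eq_zero_of_ae_deriv_le_neg_rpow {k ρ t : ℝ} (hk : 0 < k) (hρ : ρ < 1 / 2) (ht0 : 0 ≤ t)
    (hV : AbsolutelyContinuousOnInterval g 0 t) (hnn : ∀ s, 0 ≤ g s)
    (h : ∀ᵐ s : ℝ, s ∈ Set.Ioo 0 t → ∃ d ≤ 0, (0 < g s → d ≤ -(k * (g s ^ ρ) ^ 2)) ∧ HasDerivAt g d s)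
    (ht : g 0 ^ (1 - 2 * ρ) / (k * (1 - 2 * ρ)) ≤ t) : g t = 0 := by
  by_contra hne
  have hpos : 0 < g t := lt_of_le_of_ne (hnn t) (Ne.symm hne)
  have ha : 0 < 1 - 2 * ρ := by linarith
  set α := 1 - 2 * ρ with hα
  -- If `g t > 0`, monotonicity keeps `g` in `[g t, C]`, where `y ↦ y ^ α` is smooth, so `g ^ α` is
  -- again absolutely continuous. Since `α - 1 = -2ρ`, its slope is at most `-kα`, which makes `g t
  -- ^ α` nonpositive by the stated time.
  have hmono : ∀ s ∈ Set.Icc 0 t, g t ≤ g s := fun s hs =>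
    (hV.mono (by
      rw [Set.uIcc_of_le hs.2, Set.uIcc_of_le ht0]
      exact Set.Icc_subset_Icc hs.1 le_rfl)).le_of_ae_deriv_nonpos hs.2 (by
        filter_upwards [h] with r hr hrm
        obtain ⟨d, hd, -, hdd⟩ := hr ⟨hs.1.trans_lt hrm.1, hrm.2⟩
        exact ⟨d, hd, hdd⟩)
  obtain ⟨C, hC⟩ := hV.exists_bound
  have hmaps : ∀ s ∈ Set.uIcc 0 t, g s ∈ Set.Icc (g t) C := fun s hs =>
    ⟨hmono s (by rwa [Set.uIcc_of_le ht0] at hs), (le_abs_self _).trans (hC s hs)⟩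
  have hcd : ContDiffOn ℝ 1 (fun y : ℝ => y ^ α) (Set.Icc (g t) C) := fun y hy =>
    (Real.contDiffAt_rpow_const_of_ne (hpos.trans_le hy.1).ne').contDiffWithinAt
  obtain ⟨K, hK⟩ := hcd.exists_lipschitzOnWith (by decide) (convex_Icc _ _) isCompact_Icc
  have hac := hK.comp_absolutelyContinuousOnInterval hV hmaps
  have := hac.sub_le_of_ae_deriv_le (c := -(k * α)) ht0 (by
    filter_upwards [h] with s hs hsm
    obtain ⟨d, -, hd, hdd⟩ := hs hsm
    have hgs : 0 < g s := hpos.trans_le (hmono s ⟨hsm.1.le, hsm.2.le⟩)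
    refine ⟨_, ?_, hdd.rpow_const (p := α) (Or.inl hgs.ne')⟩
    have e : g s ^ (α - 1) * (g s ^ ρ) ^ 2 = 1 := by
      rw [← Real.rpow_natCast, ← Real.rpow_mul hgs.le, ← Real.rpow_add hgs]
      rw [hα]; norm_num
      convert Real.rpow_zero (g s) using 2
      ring
    have h2 := hd hgs
    have hp : 0 < g s ^ (α - 1) := Real.rpow_pos_of_pos hgs _
    calc d * α * g s ^ (α - 1) = d * (α * g s ^ (α - 1)) := by ring
      _ ≤ -(k * (g s ^ ρ) ^ 2) * (α * g s ^ (α - 1)) := by gcongr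
      _ = -(k * α) * (g s ^ (α - 1) * (g s ^ ρ) ^ 2) := by ring
      _ = -(k * α) := by rw [e, mul_one])
  rw [div_le_iff₀ (by positivity)] at ht
  have hp : 0 < g t ^ α := Real.rpow_pos_of_pos hpos _
  nlinarith

end AbsolutelyContinuous

/-! ### The nonsmooth chain rule for the potential -/

section ChainRule

variable {m : ℕ} {U : Vec m → ℝ}

/-- Continuity of the partial derivative makes `r ↦ U (y + r • e) - r * D` have small slope
uniformly for `y` near `σ`; the mean value inequality on the segment, which stays in a convex ball,
gives the limit. -/
theorem SmoothOffCoordinatePlanes.tendsto_quotient_single (hU : SmoothOffCoordinatePlanes U)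
    {σ : Vec m} {i : Fin m} (hi : σ i ≠ 0) (c : ℝ) :
    Tendsto (fun p : Vec m × ℝ =>
      (U (p.1 + p.2 • (c • EuclideanSpace.single i (1 : ℝ))) - U p.1) / p.2)
      (𝓝 σ ×ˢ 𝓝[>] (0 : ℝ)) (𝓝 (c * lineDeriv ℝ U σ (EuclideanSpace.single i 1))) := by
  set e : Vec m := EuclideanSpace.single i (1 : ℝ) with he
  set D := lineDeriv ℝ U σ e with hD
  have hopen : IsOpen {σ : Vec m | σ i ≠ 0} := isOpen_ne.preimage (by fun_prop)
  have hcont : ContinuousAt (fun σ : Vec m => lineDeriv ℝ U σ e) σ :=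
    (hU i).2.continuousAt (hopen.mem_nhds hi)
  rw [Metric.tendsto_nhds]
  intro ε hε
  -- The `+ 1` keeps the quotient meaningful when `c = 0`.
  set ε' := ε / (|c| + 1) with hε'
  have hε'0 : 0 < ε' := by positivity
  have hnear : ∀ᶠ y in 𝓝 σ, y i ≠ 0 ∧ |lineDeriv ℝ U y e - D| < ε' :=
    Filter.Eventually.and (hopen.mem_nhds hi)
      (by simpa [Real.dist_eq] using (Metric.tendsto_nhds.1 hcont.tendsto ε' hε'0))
  obtain ⟨δ, hδ, hball⟩ := Metric.eventually_nhds_iff_ball.1 hnear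
  have hseg : Tendsto (fun p : Vec m × ℝ => p.1 + (p.2 * c) • e) (𝓝 σ ×ˢ 𝓝[>] (0 : ℝ)) (𝓝 σ) := by
    simpa using tendsto_fst.add (((tendsto_snd_nhds_zero σ).mul_const c).smul_const e)
  filter_upwards [tendsto_fst.eventually (Metric.ball_mem_nhds σ hδ),
    hseg.eventually (Metric.ball_mem_nhds σ hδ), tendsto_snd.eventually self_mem_nhdsWithin]
    with p h1 h2 h3
  have hp : 0 < p.2 := h3
  have hin : ∀ r ∈ Set.uIcc 0 (p.2 * c), p.1 + r • e ∈ Metric.ball σ δ := by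
    intro r hr
    rw [← segment_eq_uIcc] at hr
    obtain ⟨a, b, ha, hb, hab, rfl⟩ := hr
    have := (convex_ball σ δ) h1 h2 ha hb hab
    convert this using 1
    rw [smul_add, ← add_assoc, ← add_smul, hab, one_smul, smul_zero, zero_add, smul_eq_mul,
      smul_smul]
  have hderiv : ∀ r ∈ Set.uIcc 0 (p.2 * c),
      HasDerivAt (fun r => U (p.1 + r • e) - r * D) (lineDeriv ℝ U (p.1 + r • e) e - D) r := by
    intro r hr
    have hl := ((hU i).1 (p.1 + r • e) (hball _ (hin r hr)).1).hasLineDerivAt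
    have h4 : HasDerivAt (fun t => U (p.1 + r • e + t • e)) (lineDeriv ℝ U (p.1 + r • e) e) (r - r) := by
      rw [sub_self]; exact hl
    have h5 := h4.comp_sub_const r r
    have h6 : (fun t => U (p.1 + r • e + (t - r) • e)) = fun t => U (p.1 + t • e) := by
      ext t; congr 1; rw [add_assoc, ← add_smul]; congr 2; ring
    rw [h6] at h5
    have h7 : HasDerivAt (fun r : ℝ => r * D) D r := by
      simpa using (hasDerivAt_id r).mul_const D
    exact h5.sub h7
  have hmvt := Convex.norm_image_sub_le_of_norm_hasDerivWithin_le
    (fun r hr => (hderiv r hr).hasDerivWithinAt)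
    (fun r hr => (hball _ (hin r hr)).2.le) (convex_uIcc 0 (p.2 * c)) Set.left_mem_uIcc
    Set.right_mem_uIcc
  simp only [zero_smul, add_zero, zero_mul, sub_zero] at hmvt
  rw [Real.dist_eq, smul_smul]
  have e1 : (U (p.1 + (p.2 * c) • e) - U p.1) / p.2 - c * D =
      (U (p.1 + (p.2 * c) • e) - p.2 * c * D - U p.1) / p.2 := by
    field_simp; ring
  rw [e1, abs_div, abs_of_pos hp, div_lt_iff₀ hp]
  rw [Real.norm_eq_abs, Real.norm_eq_abs, abs_mul, abs_of_pos hp] at hmvt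
  refine hmvt.trans_lt ?_
  have : ε' * (|c| + 1) = ε := by rw [hε']; field_simp
  nlinarith

/-- The difference quotients of a potential that is smooth off the coordinate planes converge in
all directions tangent to the coordinate planes through the point. -/
theorem SmoothOffCoordinatePlanes.exists_tendsto_quotient (hU : SmoothOffCoordinatePlanes U)
    {σ v : Vec m} (hv : ∀ i, σ i = 0 → v i = 0) :
    ∃ L, Tendsto (fun p : Vec m × ℝ => (U (p.1 + p.2 • v) - U p.1) / p.2)
      (𝓝 σ ×ˢ 𝓝[>] (0 : ℝ)) (𝓝 L) := by
  have hsum : v = ∑ i, v i • EuclideanSpace.single i (1 : ℝ) := by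
    ext j; simp [Finset.sum_apply, Pi.single_apply]
  rw [hsum]
  -- Coordinates are added one at a time: the quotient telescopes through a shifted base point,
  -- harmless because each one-coordinate limit is uniform in the base point.
  generalize (Finset.univ : Finset (Fin m)) = S
  induction S using Finset.induction_on with
  | empty => exact ⟨0, by simp⟩
  | insert i S hiS ih =>
    obtain ⟨L, hL⟩ := ih
    obtain ⟨L', hL'⟩ : ∃ L', Tendsto (fun p : Vec m × ℝ =>
        (U (p.1 + p.2 • (v i • EuclideanSpace.single i (1 : ℝ))) - U p.1) / p.2)
        (𝓝 σ ×ˢ 𝓝[>] (0 : ℝ)) (𝓝 L') := by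
      by_cases h0 : σ i = 0
      · exact ⟨0, by simp [hv i h0]⟩
      · exact ⟨_, hU.tendsto_quotient_single h0 (v i)⟩
    refine ⟨L' + L, ?_⟩
    set w : Vec m := ∑ j ∈ S, v j • EuclideanSpace.single j (1 : ℝ) with hw
    have hy : Tendsto (fun p : Vec m × ℝ => p.1 + p.2 • w) (𝓝 σ ×ˢ 𝓝[>] (0 : ℝ)) (𝓝 σ) := by
      simpa using tendsto_fst.add ((tendsto_snd_nhds_zero σ).smul_const w)
    have := (hL'.comp (hy.prodMk tendsto_snd)).add hL
    refine this.congr fun p => ?_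
    rw [Finset.sum_insert hiS, ← hw]
    simp only [Function.comp]
    rw [smul_add, add_comm (p.2 • _) (p.2 • w), ← add_assoc]
    ring

/-- In the coordinate-smooth case the quotient converges even with a moving base point, so `U°` is
that limit and the base point may be frozen; in the regular case this is the definition. -/
theorem AdmissiblePotential.tendsto_quotient (hU : AdmissiblePotential U) {σ v : Vec m}
    (hv : ∀ i, σ i = 0 → v i = 0) :
    Tendsto (fun s : ℝ => (U (σ + s • v) - U σ) / s) (𝓝[>] 0) (𝓝 (clarkeDeriv U σ v)) := by
  rcases hU.2 with h | h
  · obtain ⟨L, hL⟩ := h.exists_tendsto_quotient hv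
    rw [clarkeDeriv_eq_of_tendsto hL]
    have hc : Tendsto (fun s : ℝ => (σ, s)) (𝓝[>] 0) (𝓝 σ ×ˢ 𝓝[>] (0 : ℝ)) :=
      Tendsto.prodMk tendsto_const_nhds tendsto_id
    have := hL.comp hc
    simpa only [Function.comp_def] using this
  · exact h σ v

/-- A potential with directional derivatives `U°(σ; ±v)` along a curve through `σ` with velocity
`v` pairs every generalized gradient with `v` to the derivative along the curve. -/
theorem AdmissiblePotential.hasDerivAt_comp (hU : AdmissiblePotential U) {σ : ℝ → Vec m} {t : ℝ}
    {v ξ : Vec m} (hσ : HasDerivAt σ v t) (hd : DifferentiableAt ℝ (fun s => U (σ s)) t)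
    (hv : ∀ i, σ t i = 0 → v i = 0) (hξ : ξ ∈ clarkeGradient U (σ t)) :
    HasDerivAt (fun s => U (σ s)) (inner ℝ ξ v) t := by
  have hD := hd.hasDerivAt
  set D := deriv (fun s => U (σ s)) t
  -- the one-sided difference quotients of `U ∘ σ` in the direction `r • v`
  have key : ∀ r : ℝ, r ≠ 0 → r * D = clarkeDeriv U (σ t) (r • v) := by
    intro r hr
    -- For negative `r` the curve is sampled to the left of `t`.
    have htend : Tendsto (fun h : ℝ => h * r) (𝓝[>] 0) (𝓝[≠] 0) := by
      refine tendsto_nhdsWithin_iff.2 ⟨?_, ?_⟩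
      · have : Tendsto (fun h : ℝ => h * r) (𝓝 0) (𝓝 (0 * r)) :=
          (continuous_id.mul continuous_const).tendsto 0
        rw [zero_mul] at this
        exact this.mono_left nhdsWithin_le_nhds
      · filter_upwards [self_mem_nhdsWithin] with h hh
        exact mul_ne_zero (ne_of_gt hh) hr
    have hw : Tendsto (fun h : ℝ => h⁻¹ • (σ (t + h * r) - σ t)) (𝓝[>] 0) (𝓝 (r • v)) := by
      have h1 := (hasDerivAt_iff_tendsto_slope_zero.1 hσ).comp htend
      refine (h1.const_smul r).congr fun h => ?_
      simp only [Function.comp, smul_smul, mul_inv]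
      rw [mul_comm h⁻¹, ← mul_assoc, mul_inv_cancel₀ hr, one_mul]
    have h2 := ((hasDerivAt_iff_tendsto_slope_zero.1 hD).comp htend).const_mul r
    have h3 := tendsto_quotient_sub_quotient hU.1 (tendsto_const_nhds (x := σ t)) tendsto_id hw
      (tendsto_const_nhds (x := r • v))
    have h4 := h3.add (hU.tendsto_quotient (σ := σ t) (v := r • v) (fun i hi => by simp [hv i hi]))
    rw [zero_add] at h4
    refine tendsto_nhds_unique h2 (h4.congr' ?_)
    filter_upwards [self_mem_nhdsWithin] with h hh
    have hh' : h ≠ 0 := ne_of_gt hh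
    simp only [Function.comp, id, smul_smul, mul_inv_cancel₀ hh', one_smul, add_sub_cancel,
      smul_eq_mul]
    field_simp
    ring
  -- With `r = 1` and `r = -1`, `U°(σ; v) = D` and `U°(σ; -v) = -D`, so membership of `ξ` bounds
  -- `⟪ξ, v⟫` by `D` from both sides.
  have h1 := key 1 one_ne_zero
  have h2 := key (-1) (by norm_num)
  have h3 := hξ ((1 : ℝ) • v)
  have h4 := hξ ((-1 : ℝ) • v)
  rw [← h1, inner_smul_right] at h3
  rw [← h2, inner_smul_right] at h4
  have : inner ℝ ξ v = D := le_antisymm (by linarith) (by linarith)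
  rwa [this]

/-- Chain rule for the potential along an absolutely continuous curve. -/
theorem AdmissiblePotential.ae_hasDerivAt_comp (hU : AdmissiblePotential U) {σ : ℝ → Vec m}
    {τ : EReal} (hσ : ∀ b : ℝ, 0 < b → (b : EReal) < τ → AbsolutelyContinuousOnInterval σ 0 b) :
    ∀ᵐ t : ℝ, 0 < t → (t : EReal) < τ → ∀ v, HasDerivAt σ v t → ∀ ξ ∈ clarkeGradient U (σ t),
      HasDerivAt (fun s => U (σ s)) (inner ℝ ξ v) t := by
  refine ae_of_forall_lt fun b hb hbτ => ?_
  have hac := hσ b hb hbτ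
  have hcoord : ∀ i, AbsolutelyContinuousOnInterval (fun s => σ s i) 0 b := fun i =>
    (EuclideanSpace.proj i : Vec m →L[ℝ] ℝ).lipschitz.locallyLipschitz
      |>.comp_absolutelyContinuousOnInterval hac
  -- Sub-sliding modes enter here: while some components rest at zero, the velocity is almost
  -- everywhere tangent to their planes.
  have hz : ∀ᵐ t : ℝ, ∀ i, t ∈ Set.Ioo 0 b → σ t i = 0 → HasDerivAt (fun s => σ s i) 0 t :=
    ae_all_iff.2 fun i => (hcoord i).ae_hasDerivAt_zero_of_eq_zero
  filter_upwards [(hU.1.comp_absolutelyContinuousOnInterval hac).ae_differentiableAt, hz]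
    with t h1 h2 ht v hv ξ hξ
  refine hU.hasDerivAt_comp hv (h1 (Set.Icc_subset_uIcc ⟨ht.1.le, ht.2.le⟩)) (fun i hi => ?_) hξ
  have h3 := (EuclideanSpace.proj i : Vec m →L[ℝ] ℝ).hasFDerivAt.comp_hasDerivAt t hv
  exact h3.unique (h2 i ht hi)

end ChainRule

/-! ### Existence for differential inclusions by Euler polygons -/

section Existence

variable {V : Type*} [NormedAddCommGroup V] [InnerProductSpace ℝ V]

/-- The nodes of the Euler polygon with step `h`. -/
noncomputable def eulerNode (f : V → V) (x₀ : V) (h : ℝ) : ℕ → V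
  | 0 => x₀
  | k + 1 => eulerNode f x₀ h k + h • f (eulerNode f x₀ h k)

theorem norm_eulerNode_add_sub_le {f : V → V} {L h : ℝ} (hf : ∀ y, ‖f y‖ ≤ L) (hh : 0 ≤ h)
    (x₀ : V) (k j : ℕ) :
    ‖eulerNode f x₀ h (k + j) - eulerNode f x₀ h k‖ ≤ L * (h * j) := by
  induction j with
  | zero => simp
  | succ j ih =>
    have e : eulerNode f x₀ h (k + (j + 1)) - eulerNode f x₀ h k =
        (eulerNode f x₀ h (k + j) - eulerNode f x₀ h k) + h • f (eulerNode f x₀ h (k + j)) := by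
      rw [← add_assoc, eulerNode]; abel
    rw [e]
    refine (norm_add_le _ _).trans ?_
    rw [norm_smul, Real.norm_of_nonneg hh]
    have := mul_le_mul_of_nonneg_left (hf (eulerNode f x₀ h (k + j))) hh
    push_cast
    linarith

theorem inner_eulerNode_add_sub_le {f : V → V} {h c : ℝ} (hh : 0 ≤ h) (x₀ u : V) (k j : ℕ)
    (hc : ∀ i < j, inner ℝ (f (eulerNode f x₀ h (k + i))) u ≤ c) :
    inner ℝ (eulerNode f x₀ h (k + j) - eulerNode f x₀ h k) u ≤ c * (h * j) := by
  induction j with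
  | zero => simp
  | succ j ih =>
    have e : eulerNode f x₀ h (k + (j + 1)) - eulerNode f x₀ h k =
        (eulerNode f x₀ h (k + j) - eulerNode f x₀ h k) + h • f (eulerNode f x₀ h (k + j)) := by
      rw [← add_assoc, eulerNode]; abel
    rw [e, inner_add_left, real_inner_smul_left]
    have h1 := ih fun i hi => hc i (hi.trans (Nat.lt_succ_self j))
    have h2 := mul_le_mul_of_nonneg_left (hc j (Nat.lt_succ_self j)) hh
    push_cast
    linarith

/-- The Euler polygon with step `1 / (n + 1)`, as a step function of time. -/
noncomputable def eulerStep (f : V → V) (x₀ : V) (n : ℕ) (t : ℝ) : V :=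
  eulerNode f x₀ (1 / ((n : ℝ) + 1)) ⌊((n : ℝ) + 1) * t⌋₊

/-- The number of grid steps between two times exceeds its exact value by at most one. Negative
times are harmless because the natural floor is zero there. -/
theorem floor_sub_floor_le {a s t : ℝ} (ha : 0 ≤ a) (hst : s ≤ t) :
    (⌊a * t⌋₊ : ℝ) - ⌊a * s⌋₊ ≤ a * (t - s) + 1 := by
  rcases le_total 0 t with ht | ht
  · have h1 := Nat.floor_le (mul_nonneg ha ht)
    have h2 := (Nat.lt_floor_add_one (a * s)).le
    linarith
  · rw [Nat.floor_of_nonpos (mul_nonpos_of_nonneg_of_nonpos ha ht)]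
    have : 0 ≤ a * (t - s) := mul_nonneg ha (by linarith)
    have h3 : (0 : ℝ) ≤ ⌊a * s⌋₊ := Nat.cast_nonneg _
    push_cast
    linarith

theorem norm_eulerStep_sub_le {f : V → V} {L : ℝ} (hf : ∀ y, ‖f y‖ ≤ L) (x₀ : V) (n : ℕ)
    {s t : ℝ} (hst : s ≤ t) :
    ‖eulerStep f x₀ n t - eulerStep f x₀ n s‖ ≤ L * (t - s + 1 / ((n : ℝ) + 1)) := by
  have hn : (0 : ℝ) < (n : ℝ) + 1 := by positivity
  have hle : ⌊((n : ℝ) + 1) * s⌋₊ ≤ ⌊((n : ℝ) + 1) * t⌋₊ := Nat.floor_mono (by gcongr)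
  obtain ⟨j, hj⟩ := Nat.exists_eq_add_of_le hle
  have h1 := norm_eulerNode_add_sub_le hf (by positivity : 0 ≤ 1 / ((n : ℝ) + 1)) x₀
    ⌊((n : ℝ) + 1) * s⌋₊ j
  rw [eulerStep, eulerStep, hj]
  refine h1.trans ?_
  have hL : 0 ≤ L := (norm_nonneg _).trans (hf 0)
  have h2 := floor_sub_floor_le hn.le hst
  rw [hj] at h2
  push_cast at h2
  refine mul_le_mul_of_nonneg_left ?_ hL
  rw [one_div, inv_mul_le_iff₀ hn, mul_add, mul_inv_cancel₀ hn.ne']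
  linarith

variable [FiniteDimensional ℝ V]

/-- A limit of Euler polygons is Lipschitz, and its velocities satisfy every one-sided bound that the
field satisfies near the current point. -/
theorem exists_euler_limit {f : V → V} {L : NNReal} (hf : ∀ y, ‖f y‖ ≤ L) (x₀ : V) :
    ∃ x : ℝ → V, x 0 = x₀ ∧ LipschitzWith L x ∧ ∀ t : ℝ, 0 < t → ∀ w, HasDerivAt x w t →
      ∀ u c, (∀ᶠ y in 𝓝 (x t), inner ℝ (f y) u ≤ c) → inner ℝ w u ≤ c := by
  -- Convergence along one ultrafilter gives limits at all times simultaneously, without extracting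
  -- subsequences.
  have hbound : ∀ t : ℝ, ∃ z : V, Tendsto (fun n => eulerStep f x₀ n t) (hyperfilter ℕ) (𝓝 z) := by
    intro t
    have hK : IsCompact (Metric.closedBall x₀ (L * (|t| + 1))) :=
      isCompact_closedBall _ _
    have hz : ∀ n, eulerStep f x₀ n 0 = x₀ := fun n => by simp [eulerStep, eulerNode]
    have hmem : ∀ n, eulerStep f x₀ n t ∈ Metric.closedBall x₀ (L * (|t| + 1)) := by
      intro n
      rw [mem_closedBall_iff_norm]
      have hn1 : 1 / ((n : ℝ) + 1) ≤ 1 := by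
        rw [div_le_one (by positivity)]; linarith [(Nat.cast_nonneg n : (0 : ℝ) ≤ n)]
      rcases le_total 0 t with ht | ht
      · have h := norm_eulerStep_sub_le hf x₀ n ht
        rw [hz] at h
        refine h.trans ?_
        rw [abs_of_nonneg ht]; gcongr; linarith
      · have h := norm_eulerStep_sub_le hf x₀ n ht
        rw [hz, norm_sub_rev] at h
        refine h.trans ?_
        rw [abs_of_nonpos ht]; gcongr; linarith
    obtain ⟨z, -, hz'⟩ := hK.ultrafilter_le_nhds ((hyperfilter ℕ).map fun n => eulerStep f x₀ n t)
      (by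
        rw [le_principal_iff]
        exact Filter.mem_map.2 (Filter.univ_mem' hmem))
    exact ⟨z, hz'⟩
  choose x hx using hbound
  have hinv : Tendsto (fun n : ℕ => 1 / ((n : ℝ) + 1)) (hyperfilter ℕ) (𝓝 0) :=
    tendsto_one_div_add_atTop_nhds_zero_nat.mono_left Nat.hyperfilter_le_atTop
  have hlip : ∀ s t : ℝ, s ≤ t → ‖x t - x s‖ ≤ L * (t - s) := by
    intro s t hst
    refine le_of_tendsto_of_tendsto ((hx t).sub (hx s)).norm ?_
      (Eventually.of_forall fun n => norm_eulerStep_sub_le hf x₀ n hst)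
    simpa using (hinv.const_add (t - s)).const_mul (L : ℝ)
  refine ⟨x, ?_, ?_, ?_⟩
  · refine tendsto_nhds_unique (hx 0) ?_
    simp [eulerStep, eulerNode]
  · refine LipschitzWith.of_dist_le_mul fun s t => ?_
    rcases le_total s t with hst | hst
    · rw [dist_comm, dist_eq_norm, dist_comm, Real.dist_eq, abs_of_nonneg (by linarith)]
      exact hlip s t hst
    · rw [dist_eq_norm, Real.dist_eq, abs_of_nonneg (by linarith)]
      exact hlip t s hst
  · intro t ht w hw u c hc
    obtain ⟨δ, hδ, hball⟩ := Metric.eventually_nhds_iff_ball.1 hc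
    -- The thirds of `δ` pay for the distance from polygon to limit, the displacement during time
    -- `h`, and one extra Euler step; the nodes in between then lie where the one-sided bound holds.
    have hmain : ∀ h : ℝ, 0 < h → L * h < δ / 3 → inner ℝ (x (t + h) - x t) u ≤ c * h := by
      intro h hh hLh
      have hlim1 : Tendsto (fun n => inner ℝ (eulerStep f x₀ n (t + h) - eulerStep f x₀ n t) u)
          (hyperfilter ℕ) (𝓝 (inner ℝ (x (t + h) - x t) u)) :=
        ((hx (t + h)).sub (hx t)).inner tendsto_const_nhds
      have hlim2 : Tendsto (fun n : ℕ => c * h + |c| * (1 / ((n : ℝ) + 1)))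
          (hyperfilter ℕ) (𝓝 (c * h)) := by
        simpa using (hinv.const_mul |c|).const_add (c * h)
      refine le_of_tendsto_of_tendsto hlim1 hlim2 ?_
      have hsmall : ∀ᶠ n : ℕ in hyperfilter ℕ, L * (1 / ((n : ℝ) + 1)) < δ / 3 := by
        have := hinv.const_mul (L : ℝ)
        rw [mul_zero] at this
        exact this.eventually (gt_mem_nhds (by positivity))
      filter_upwards [hsmall, (hx t).eventually (Metric.ball_mem_nhds _ (by positivity : 0 < δ / 3))]
        with n hn1 hn2
      have hn : (0 : ℝ) < (n : ℝ) + 1 := by positivity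
      have hstep : (0 : ℝ) ≤ 1 / ((n : ℝ) + 1) := by positivity
      have hle : ⌊((n : ℝ) + 1) * t⌋₊ ≤ ⌊((n : ℝ) + 1) * (t + h)⌋₊ :=
        Nat.floor_mono (by gcongr; linarith)
      obtain ⟨j, hj⟩ := Nat.exists_eq_add_of_le hle
      have h2 := floor_sub_floor_le hn.le (by linarith : t ≤ t + h)
      rw [hj] at h2
      push_cast at h2
      have h2' : 1 / ((n : ℝ) + 1) * j ≤ h + 1 / ((n : ℝ) + 1) := by
        rw [one_div, inv_mul_le_iff₀ hn, mul_add, mul_inv_cancel₀ hn.ne']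
        linarith
      have h3 : h - 1 / ((n : ℝ) + 1) ≤ 1 / ((n : ℝ) + 1) * j := by
        rw [one_div, le_inv_mul_iff₀ hn, mul_sub, mul_inv_cancel₀ hn.ne']
        have h4 := Nat.floor_le (mul_nonneg hn.le ht.le)
        have h5 := (Nat.lt_floor_add_one (((n : ℝ) + 1) * (t + h))).le
        rw [hj] at h5
        push_cast at h5
        linarith
      have h6 := inner_eulerNode_add_sub_le (f := f) (c := c) hstep x₀ u ⌊((n : ℝ) + 1) * t⌋₊ j (by
        intro i hi
        refine hball _ ?_
        have h7 := norm_eulerNode_add_sub_le hf hstep x₀ ⌊((n : ℝ) + 1) * t⌋₊ i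
        have h8 : (L : ℝ) * (1 / ((n : ℝ) + 1) * i) ≤ L * (h + 1 / ((n : ℝ) + 1)) := by
          refine mul_le_mul_of_nonneg_left (le_trans ?_ h2') L.coe_nonneg
          gcongr
        have h9 : dist (eulerStep f x₀ n t) (x t) < δ / 3 := hn2
        rw [dist_eq_norm] at h9
        rw [mem_ball_iff_norm]
        calc _ = ‖(eulerNode f x₀ (1 / ((n : ℝ) + 1)) (⌊((n : ℝ) + 1) * t⌋₊ + i) -
              eulerStep f x₀ n t) + (eulerStep f x₀ n t - x t)‖ := by congr 1; abel
          _ ≤ _ := norm_add_le _ _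
          _ < δ := by
            rw [← eulerStep] at h7
            linarith)
      rw [eulerStep, eulerStep, hj]
      refine h6.trans ?_
      have h10 : |1 / ((n : ℝ) + 1) * j - h| ≤ 1 / ((n : ℝ) + 1) := by
        rw [abs_le]; constructor <;> linarith
      have h11 : c * (1 / ((n : ℝ) + 1) * j - h) ≤ |c| * (1 / ((n : ℝ) + 1)) :=
        (le_abs_self _).trans (by rw [abs_mul]; gcongr)
      linarith
    have hd : Tendsto (fun h : ℝ => inner ℝ (h⁻¹ • (x (t + h) - x t)) u) (𝓝[>] 0)
        (𝓝 (inner ℝ w u)) :=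
      ((hasDerivAt_iff_tendsto_slope_zero.1 hw).mono_left
        (nhdsWithin_mono _ fun h hh => ne_of_gt hh)).inner tendsto_const_nhds
    refine le_of_tendsto hd ?_
    have hsm : ∀ᶠ h : ℝ in 𝓝[>] 0, L * h < δ / 3 := by
      have : Tendsto (fun h : ℝ => L * h) (𝓝[>] 0) (𝓝 (L * 0)) :=
        ((continuous_const.mul continuous_id).tendsto 0).mono_left nhdsWithin_le_nhds
      rw [mul_zero] at this
      exact this.eventually (gt_mem_nhds (by positivity))
    filter_upwards [hsm, self_mem_nhdsWithin] with h h1 h2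
    have hpos : 0 < h := h2
    rw [real_inner_smul_left, inv_mul_le_iff₀ hpos, mul_comm h c]
    exact hmain h hpos h1

/-- Local existence for differential inclusions: bounded nonempty values, each cut out by
the half-spaces that contain the values at all nearby points. -/
theorem exists_lipschitz_solution_in_ball {F : V → Set V} {R : ℝ} {L : NNReal}
    (hne : ∀ y ∈ Metric.ball (0 : V) R, (F y).Nonempty)
    (hbd : ∀ y ∈ Metric.ball (0 : V) R, ∀ w ∈ F y, ‖w‖ ≤ L)
    (hcl : ∀ y ∈ Metric.ball (0 : V) R, ∀ w,
      (∀ u c, (∀ᶠ z in 𝓝 y, ∀ w' ∈ F z, inner ℝ w' u ≤ c) → inner ℝ w u ≤ c) → w ∈ F y)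
    (x₀ : V) :
    ∃ x : ℝ → V, x 0 = x₀ ∧ LipschitzWith L x ∧
      ∀ t : ℝ, 0 < t → x t ∈ Metric.ball (0 : V) R → ∀ w, HasDerivAt x w t → w ∈ F (x t) := by
  classical
  -- Extending the selection by zero outside the ball keeps it globally bounded, so the polygons
  -- exist for all times; the inclusion is claimed only inside the ball.
  have hsel : ∃ f : V → V, (∀ y ∈ Metric.ball (0 : V) R, f y ∈ F y) ∧ ∀ y, ‖f y‖ ≤ L := by
    choose! g hg using hne
    refine ⟨fun y => if y ∈ Metric.ball (0 : V) R then g y else 0, fun y hy => ?_, fun y => ?_⟩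
    · simpa only [if_pos hy] using hg y hy
    · by_cases hy : y ∈ Metric.ball (0 : V) R
      · simpa only [if_pos hy] using hbd y hy _ (hg y hy)
      · simp only [if_neg hy, norm_zero]; exact L.coe_nonneg
  obtain ⟨f, hfF, hfL⟩ := hsel
  obtain ⟨x, hx0, hxL, hx⟩ := exists_euler_limit hfL x₀
  refine ⟨x, hx0, hxL, fun t ht hb w hw => hcl _ hb w fun u c huc => hx t ht w hw u c ?_⟩
  filter_upwards [huc, Metric.isOpen_ball.mem_nhds hb] with y h1 h2
  exact h1 _ (hfF y h2)

end Existence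

/-! ### Lyapunov stability and continuation of solutions -/

section Stability

variable {V : Type*} [NormedAddCommGroup V] [InnerProductSpace ℝ V] {F : V → Set V} {W : V → ℝ}

theorem IsSolution.continuousOn {x : ℝ → V} {τ : EReal} (hx : IsSolution F x τ) {t : ℝ}
    (ht0 : 0 ≤ t) (ht : (t : EReal) < τ) : ContinuousOn x (Set.Icc 0 t) := by
  rcases ht0.eq_or_lt with rfl | h0
  · rw [Set.Icc_self]; exact continuousOn_singleton x 0
  · rw [← Set.uIcc_of_le ht0]; exact (hx.1 t h0 ht).continuousOn

/-- The level is the minimum of `W` on the compact shell `ε ≤ ‖x‖ ≤ r₀`; if the shell is empty, any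
positive number serves. -/
theorem exists_level [FiniteDimensional ℝ V] {r₀ ε : ℝ} (hW : Continuous W)
    (hpos : ∀ x, ‖x‖ ≤ r₀ → x ≠ 0 → 0 < W x) (hε : 0 < ε) :
    ∃ l > 0, ∀ x, ε ≤ ‖x‖ → ‖x‖ ≤ r₀ → l ≤ W x := by
  have hK : IsCompact (Metric.closedBall (0 : V) r₀ ∩ {x | ε ≤ ‖x‖}) :=
    (isCompact_closedBall _ _).inter_right (isClosed_le continuous_const continuous_norm)
  rcases (Metric.closedBall (0 : V) r₀ ∩ {x | ε ≤ ‖x‖}).eq_empty_or_nonempty with he | hne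
  · refine ⟨1, one_pos, fun x h1 h2 => ?_⟩
    have : x ∈ Metric.closedBall (0 : V) r₀ ∩ {x | ε ≤ ‖x‖} := ⟨by simpa using h2, h1⟩
    rw [he] at this
    exact this.elim
  · obtain ⟨z, hz, hmin⟩ := hK.exists_isMinOn hne hW.continuousOn
    refine ⟨W z, hpos z (by simpa using hz.1) ?_, fun x h1 h2 => hmin ⟨by simpa using h2, h1⟩⟩
    rintro rfl
    have : ε ≤ ‖(0 : V)‖ := hz.2
    rw [norm_zero] at this
    linarith

/-- An escaping curve would cross the sphere of radius `r`, where `W` is at least `l`, although `W`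
started below `l` and cannot increase. -/
theorem IsSolution.norm_lt_of_level
    (hmono : ∀ (τ : EReal) (x : ℝ → V), IsSolution F x τ →
      ∀ s t : ℝ, 0 ≤ s → s ≤ t → (t : EReal) < τ → W (x t) ≤ W (x s))
    {r l : ℝ} (hl : ∀ x, ‖x‖ = r → l ≤ W x) {x : ℝ → V} {τ : EReal} (hx : IsSolution F x τ)
    (h0 : ‖x 0‖ < r) (hW0 : W (x 0) < l) {t : ℝ} (ht0 : 0 ≤ t) (ht : (t : EReal) < τ) :
    ‖x t‖ < r := by
  by_contra! hlt
  obtain ⟨s, hs, hsr⟩ := intermediate_value_Icc ht0 (hx.continuousOn ht0 ht).norm ⟨h0.le, hlt⟩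
  have hsτ : (s : EReal) < τ := lt_of_le_of_lt (by exact_mod_cast hs.2) ht
  have := hmono τ x hx 0 s le_rfl hs.1 hsτ
  linarith [hl _ hsr]

theorem isSolution_of_lipschitzWith [FiniteDimensional ℝ V] {x : ℝ → V} {τ : EReal} {L : NNReal}
    (hx : LipschitzWith L x)
    (h : ∀ᵐ t : ℝ, 0 < t → (t : EReal) < τ → ∀ w, HasDerivAt x w t → w ∈ F (x t)) :
    IsSolution F x τ := by
  refine ⟨fun b _ _ => hx.lipschitzOnWith.absolutelyContinuousOnInterval, ?_⟩
  filter_upwards [hx.ae_differentiableAt_real, h] with t ht ht' h0 hτ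
  exact ⟨_, ht' h0 hτ _ ht.hasDerivAt, ht.hasDerivAt⟩

theorem lipschitzWith_ite {E : Type*} [PseudoMetricSpace E] {x y : ℝ → E} {K : NNReal} {a : ℝ}
    (hx : LipschitzWith K x)
    (hy : LipschitzWith K y) (h : x a = y a) :
    LipschitzWith K (fun t => if t < a then x t else y t) := by
  have key : ∀ s t : ℝ, s ≤ t →
      dist (if s < a then x s else y s) (if t < a then x t else y t) ≤ K * dist s t := by
    intro s t hst
    split_ifs with h1 h2 h2
    · exact hx.dist_le_mul s t
    · have e1 := hx.dist_le_mul s a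
      have e2 := hy.dist_le_mul a t
      rw [not_lt] at h2
      rw [Real.dist_eq, abs_of_nonpos (by linarith)] at e1 e2 ⊢
      have := dist_triangle (x s) (x a) (y t)
      rw [h] at this e1
      linarith
    · exact absurd (hst.trans_lt h2) h1
    · exact hy.dist_le_mul s t
  refine LipschitzWith.of_dist_le_mul fun s t => ?_
  rcases le_total s t with hst | hst
  · exact key s t hst
  · rw [dist_comm, dist_comm s t]; exact key t s hst

variable [FiniteDimensional ℝ V] {r l : ℝ} {L : NNReal}

/-- The Euler limit could violate the inclusion only after leaving the ball. Up to a first exit time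
it is a solution, so `W` does not increase; by continuity `W < l` at the exit point, which lies on
the sphere. -/
theorem exists_lipschitz_solution_of_level (hW : Continuous W)
    (hmono : ∀ (τ : EReal) (x : ℝ → V), IsSolution F x τ →
      ∀ s t : ℝ, 0 ≤ s → s ≤ t → (t : EReal) < τ → W (x t) ≤ W (x s))
    (hne : ∀ y ∈ Metric.ball (0 : V) r, (F y).Nonempty)
    (hbd : ∀ y ∈ Metric.ball (0 : V) r, ∀ w ∈ F y, ‖w‖ ≤ L)
    (hcl : ∀ y ∈ Metric.ball (0 : V) r, ∀ w,
      (∀ u c, (∀ᶠ z in 𝓝 y, ∀ w' ∈ F z, inner ℝ w' u ≤ c) → inner ℝ w u ≤ c) → w ∈ F y)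
    (hl : ∀ x, ‖x‖ = r → l ≤ W x) {x₀ : V} (h0 : ‖x₀‖ < r) (hW0 : W x₀ < l) :
    ∃ y : ℝ → V, y 0 = x₀ ∧ LipschitzWith L y ∧ IsSolution F y ⊤ := by
  obtain ⟨y, hy0, hyL, hy⟩ := exists_lipschitz_solution_in_ball hne hbd hcl x₀
  refine ⟨y, hy0, hyL, ?_⟩
  suffices H : ∀ t : ℝ, 0 ≤ t → ‖y t‖ < r from
    isSolution_of_lipschitzWith hyL
      (Eventually.of_forall fun t ht _ => hy t ht (by simpa using H t ht.le))
  by_contra! hcon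
  have hcont : Continuous fun t => ‖y t‖ := hyL.continuous.norm
  set S : Set ℝ := {t | 0 ≤ t ∧ r ≤ ‖y t‖} with hS
  have hSne : S.Nonempty := hcon
  have hSb : BddBelow S := ⟨0, fun t ht => ht.1⟩
  have hScl : IsClosed S :=
    (isClosed_le continuous_const continuous_id).inter (isClosed_le continuous_const hcont)
  have ht1 : sInf S ∈ S := hScl.csInf_mem hSne hSb
  set t₁ := sInf S
  have hlt : ∀ t, 0 ≤ t → t < t₁ → ‖y t‖ < r := by
    intro t h0' h1
    by_contra! h2
    exact absurd (csInf_le hSb ⟨h0', h2⟩) (not_le.2 h1)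
  have ht1pos : 0 < t₁ := by
    rcases ht1.1.eq_or_lt with h | h
    · have := ht1.2
      rw [← h, hy0] at this
      linarith
    · exact h
  have hsol : IsSolution F y (t₁ : EReal) :=
    isSolution_of_lipschitzWith hyL (Eventually.of_forall fun t ht h1 =>
      hy t ht (by simpa using hlt t ht.le (by exact_mod_cast h1)))
  have hnear : ∀ᶠ t in 𝓝[<] t₁, 0 ≤ t ∧ t < t₁ := by
    filter_upwards [Ioo_mem_nhdsLT ht1pos] with t ht using ⟨ht.1.le, ht.2⟩
  have hWle : W (y t₁) ≤ W (y 0) := by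
    refine le_of_tendsto (((hW.comp hyL.continuous).tendsto t₁).mono_left nhdsWithin_le_nhds
      : Tendsto _ (𝓝[<] t₁) _) ?_
    filter_upwards [hnear] with t ht
    exact hmono _ y hsol 0 t le_rfl ht.1 (by exact_mod_cast ht.2)
  have hnle : ‖y t₁‖ ≤ r := by
    refine le_of_tendsto ((hcont.tendsto t₁).mono_left nhdsWithin_le_nhds
      : Tendsto _ (𝓝[<] t₁) _) ?_
    filter_upwards [hnear] with t ht using (hlt t ht.1 ht.2).le
  have := hl _ (le_antisymm hnle ht1.2)
  rw [hy0] at hWle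
  linarith

/-- Solutions in a sublevel set can be continued for all times. -/
theorem IsSolution.exists_continuation (hW : Continuous W)
    (hmono : ∀ (τ : EReal) (x : ℝ → V), IsSolution F x τ →
      ∀ s t : ℝ, 0 ≤ s → s ≤ t → (t : EReal) < τ → W (x t) ≤ W (x s))
    (hne : ∀ y ∈ Metric.ball (0 : V) r, (F y).Nonempty)
    (hbd : ∀ y ∈ Metric.ball (0 : V) r, ∀ w ∈ F y, ‖w‖ ≤ L)
    (hcl : ∀ y ∈ Metric.ball (0 : V) r, ∀ w,
      (∀ u c, (∀ᶠ z in 𝓝 y, ∀ w' ∈ F z, inner ℝ w' u ≤ c) → inner ℝ w u ≤ c) → w ∈ F y)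
    (hl : ∀ x, ‖x‖ = r → l ≤ W x) {x : ℝ → V} {τ : EReal} (hx : IsSolution F x τ)
    (h0 : ‖x 0‖ < r) (hW0 : W (x 0) < l) :
    ∃ y : ℝ → V, IsSolution F y ⊤ ∧ ∀ t : ℝ, 0 ≤ t → (t : EReal) < τ → y t = x t := by
  induction τ with
  | top => exact ⟨x, hx, fun _ _ _ => rfl⟩
  | bot =>
    obtain ⟨y, -, -, hy⟩ := exists_lipschitz_solution_of_level hW hmono hne hbd hcl hl h0 hW0
    exact ⟨y, hy, fun t _ h => absurd h not_lt_bot⟩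
  | coe a =>
    rcases le_or_gt a 0 with ha | ha
    · obtain ⟨y, -, -, hy⟩ := exists_lipschitz_solution_of_level hW hmono hne hbd hcl hl h0 hW0
      refine ⟨y, hy, fun t h1 h2 => ?_⟩
      have : t < a := by exact_mod_cast h2
      linarith
    have hconf : ∀ t : ℝ, 0 ≤ t → t < a → ‖x t‖ < r := fun t h1 h2 =>
      hx.norm_lt_of_level hmono hl h0 hW0 h1 (by exact_mod_cast h2)
    have hlipb : ∀ b, 0 < b → b < a → LipschitzOnWith L x (Set.Icc 0 b) := by
      intro b hb hba
      refine (hx.1 b hb (by exact_mod_cast hba)).lipschitzOnWith_of_ae_norm_deriv_le ?_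
      filter_upwards [hx.2] with t ht htm
      have hta : t < a := htm.2.trans hba
      obtain ⟨w, hw, hd⟩ := ht htm.1 (by exact_mod_cast hta)
      exact ⟨w, hbd _ (by simpa using hconf t htm.1.le hta) w hw, hd⟩
    -- Bounded speed makes the curve Lipschitz up to the open end, so a Lipschitz extension supplies
    -- the endpoint from which a new solution starts.
    have hlip : LipschitzOnWith L x (Set.Ico 0 a) := by
      intro s hs t ht
      rcases (le_max_left s t |> hs.1.trans).eq_or_lt with h | h
      · have h1 : s = 0 := le_antisymm (by rw [h]; exact le_max_left _ _) hs.1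
        have h2 : t = 0 := le_antisymm (by rw [h]; exact le_max_right _ _) ht.1
        simp [h1, h2]
      · exact hlipb (max s t) h (max_lt hs.2 ht.2) ⟨hs.1, le_max_left _ _⟩ ⟨ht.1, le_max_right _ _⟩
    obtain ⟨g, hg, hgx⟩ := hlip.extend_finite_dimension
    set C := lipschitzExtensionConstant V * L
    have hgx0 : g 0 = x 0 := (hgx ⟨le_rfl, ha⟩).symm
    have hnear : ∀ᶠ t in 𝓝[<] a, 0 ≤ t ∧ t < a := by
      filter_upwards [Ioo_mem_nhdsLT ha] with t ht using ⟨ht.1.le, ht.2⟩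
    have hga : ‖g a‖ ≤ r := by
      refine le_of_tendsto ((hg.continuous.norm.tendsto a).mono_left nhdsWithin_le_nhds
        : Tendsto _ (𝓝[<] a) _) ?_
      filter_upwards [hnear] with t ht
      rw [← hgx ⟨ht.1, ht.2⟩]
      exact (hconf t ht.1 ht.2).le
    have hWa : W (g a) ≤ W (x 0) := by
      refine le_of_tendsto (((hW.comp hg.continuous).tendsto a).mono_left nhdsWithin_le_nhds
        : Tendsto _ (𝓝[<] a) _) ?_
      filter_upwards [hnear] with t ht
      simp only [Function.comp]
      rw [← hgx ⟨ht.1, ht.2⟩]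
      exact hmono _ x hx 0 t le_rfl ht.1 (by exact_mod_cast ht.2)
    have hga' : ‖g a‖ < r := lt_of_le_of_ne hga fun h => by linarith [hl _ h]
    obtain ⟨z, hz0, hzL, hz⟩ := exists_lipschitz_solution_of_level hW hmono hne hbd hcl hl hga'
      (hWa.trans_lt hW0)
    have hzshift : LipschitzWith (max C L) fun t => z (t - a) := by
      refine LipschitzWith.of_dist_le_mul fun s t => ?_
      have := (hzL.weaken (le_max_right C L)).dist_le_mul (s - a) (t - a)
      rwa [dist_sub_right] at this
    have hy := lipschitzWith_ite (hg.weaken (le_max_left C L)) hzshift (a := a) (by simp [hz0])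
    refine ⟨fun t => if t < a then g t else z (t - a), ?_, fun t h1 h2 => ?_⟩
    · refine ⟨fun b _ _ => hy.lipschitzOnWith.absolutelyContinuousOnInterval, ?_⟩
      -- Translation preserves null sets, so the shifted solution satisfies the inclusion almost
      -- everywhere; the gluing instant `a` is discarded below.
      have hz2 : ∀ᵐ t : ℝ, 0 < t - a → ((t - a : ℝ) : EReal) < ⊤ →
          ∃ w ∈ F (z (t - a)), HasDerivAt z w (t - a) :=
        (measurePreserving_sub_right volume a).quasiMeasurePreserving.ae hz.2
      have hne : ∀ᵐ t : ℝ, t ≠ a := by simp [ae_iff]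
      filter_upwards [hx.2, hz2, hne] with t h1 h2 h3 ht _
      rcases lt_or_gt_of_ne h3 with hta | hta
      · obtain ⟨w, hw, hd⟩ := h1 ht (by exact_mod_cast hta)
        refine ⟨w, ?_, hd.congr_of_eventuallyEq ?_⟩
        · simp only [if_pos hta]
          rwa [← hgx ⟨ht.le, hta⟩]
        · filter_upwards [Ioo_mem_nhds ht hta] with s hs
          simp only [if_pos hs.2]
          exact (hgx ⟨hs.1.le, hs.2⟩).symm
      · obtain ⟨w, hw, hd⟩ := h2 (by linarith) (EReal.coe_lt_top _)
        refine ⟨w, ?_, (hd.comp_sub_const t a).congr_of_eventuallyEq ?_⟩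
        · simpa only [if_neg (not_lt.2 hta.le)] using hw
        · filter_upwards [Ioi_mem_nhds hta] with s hs
          have hs' : a < s := hs
          simp only [if_neg (not_lt.2 hs'.le)]
    · have h3 : t < a := by exact_mod_cast h2
      simp only [if_pos h3]
      exact (hgx ⟨h1, h3⟩).symm

/-- Lyapunov's stability theorem for differential inclusions, including existence and continuation
of solutions. -/
theorem stableAtOrigin_of_lyapunov {r₀ : ℝ} (hr₀ : 0 < r₀) (hW : Continuous W) (hW0 : W 0 = 0)
    (hpos : ∀ x, ‖x‖ ≤ r₀ → x ≠ 0 → 0 < W x)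
    (hmono : ∀ (τ : EReal) (x : ℝ → V), IsSolution F x τ →
      ∀ s t : ℝ, 0 ≤ s → s ≤ t → (t : EReal) < τ → W (x t) ≤ W (x s))
    (hne : ∀ y, (F y).Nonempty)
    (hbd : ∀ y ∈ Metric.ball (0 : V) r₀, ∀ w ∈ F y, ‖w‖ ≤ L)
    (hcl : ∀ y, ∀ w,
      (∀ u c, (∀ᶠ z in 𝓝 y, ∀ w' ∈ F z, inner ℝ w' u ≤ c) → inner ℝ w u ≤ c) → w ∈ F y) :
    StableAtOrigin F := by
  intro ε hε
  set ρ := min ε r₀ with hρ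
  have hρ0 : 0 < ρ := lt_min hε hr₀
  obtain ⟨k, hk, hlev⟩ := exists_level hW hpos hρ0
  have hlev' : ∀ x, ‖x‖ = ρ → k ≤ W x := fun x hx => hlev x hx.ge (hx.le.trans (min_le_right _ _))
  have hev : ∀ᶠ x in 𝓝 (0 : V), W x < k :=
    (hW.tendsto 0).eventually (gt_mem_nhds (by rwa [hW0]))
  obtain ⟨δ, hδ, hball⟩ := Metric.eventually_nhds_iff.1 hev
  have hbd' : ∀ y ∈ Metric.ball (0 : V) ρ, ∀ w ∈ F y, ‖w‖ ≤ L := fun y hy =>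
    hbd y (Metric.ball_subset_ball (min_le_right _ _) hy)
  refine ⟨min δ ρ, lt_min hδ hρ0, fun x₀ hx₀ => ⟨?_, fun τ x hx0 hx => ⟨?_, fun t h1 h2 => ?_⟩⟩⟩
  · obtain ⟨y, h1, -, h2⟩ := exists_lipschitz_solution_of_level hW hmono (fun y _ => hne y) hbd'
      (fun y _ => hcl y) hlev' (hx₀.trans_le (min_le_right _ _))
      (hball (by simpa using hx₀.trans_le (min_le_left _ _)))
    exact ⟨y, h1, h2⟩
  · exact hx.exists_continuation hW hmono (fun y _ => hne y) hbd'
      (fun y _ => hcl y) hlev' (by rw [hx0]; exact hx₀.trans_le (min_le_right _ _))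
      (hball (by simpa [hx0] using hx₀.trans_le (min_le_left _ _)))
  · exact (hx.norm_lt_of_level hmono hlev' (by rw [hx0]; exact hx₀.trans_le (min_le_right _ _))
      (hball (by simpa [hx0] using hx₀.trans_le (min_le_left _ _))) h1 h2).trans_le (min_le_left _ _)

/-- A curve near the origin converges to it when a positive definite function tends to zero along
it. -/
theorem tendsto_zero_of_tendsto_lyapunov {r₀ : ℝ} (hW : Continuous W)
    (hpos : ∀ x, ‖x‖ ≤ r₀ → x ≠ 0 → 0 < W x) {x : ℝ → V} (hx : ∀ᶠ t in atTop, ‖x t‖ ≤ r₀)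
    (hlim : Tendsto (fun t => W (x t)) atTop (𝓝 0)) : Tendsto x atTop (𝓝 0) := by
  rw [Metric.tendsto_nhds]
  intro ε hε
  obtain ⟨k, hk, hlev⟩ := exists_level hW hpos hε
  filter_upwards [hlim.eventually (gt_mem_nhds hk), hx] with t h1 h2
  rw [dist_zero_right]
  by_contra! h3
  linarith [hlev _ h3 h2]

end Stability

/-! ### The set-valued field `J(x) ∂f(x)` -/

section ClarkeField

variable {V : Type*} [NormedAddCommGroup V] [InnerProductSpace ℝ V] [FiniteDimensional ℝ V]
  {f : V → ℝ} {J : V → V →L[ℝ] V}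

theorem exists_bound_clarkeField (hf : LocallyLipschitz f) (hJ : Continuous J) (r : ℝ) :
    ∃ L : NNReal, ∀ y ∈ Metric.ball (0 : V) r, ∀ w ∈ J y '' clarkeGradient f y, ‖w‖ ≤ L := by
  have hc : IsCompact (Metric.closedBall (0 : V) r) := isCompact_closedBall _ _
  obtain ⟨K, hK⟩ := LocallyLipschitzOn.exists_lipschitzOnWith_of_compact hc hf.locallyLipschitzOn
  obtain ⟨C, hC⟩ := hc.exists_bound_of_continuousOn hJ.continuousOn
  refine ⟨C.toNNReal * K, ?_⟩
  rintro y hy w ⟨ζ, hζ, rfl⟩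
  have h1 : ‖ζ‖ ≤ K := norm_le_of_mem_clarkeGradient hf
    (mem_of_superset (Metric.isOpen_ball.mem_nhds hy) Metric.ball_subset_closedBall) hK hζ
  have h2 := hC y (Metric.ball_subset_closedBall hy)
  refine ((J y).le_opNorm ζ).trans ?_
  push_cast
  gcongr
  exact h2.trans (Real.le_coe_toNNReal C)

/-- The values of the inclusion `x' ∈ J(x) ∂f(x)` are cut out by the half-spaces that contain the
values at all nearby points. -/
theorem mem_clarkeField_of_forall (hf : LocallyLipschitz f) (hJ : Continuous J)
    (hneg : ∀ y z, z ≠ 0 → inner ℝ z (J y z) < 0) (y w : V)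
    (h : ∀ u c, (∀ᶠ z in 𝓝 y, ∀ w' ∈ J z '' clarkeGradient f z, inner ℝ w' u ≤ c) →
      inner ℝ w u ≤ c) : w ∈ J y '' clarkeGradient f y := by
  -- Negative definiteness of the quadratic form makes both `J y` and its adjoint injective, hence
  -- bijective in finite dimension.
  have hinj : Function.Injective (J y) := by
    refine (injective_iff_map_eq_zero (J y)).2 fun z hz => ?_
    by_contra hne
    have := hneg y z hne
    rw [hz, inner_zero_right] at this
    exact lt_irrefl _ this
  have hinj' : Function.Injective (ContinuousLinearMap.adjoint (J y)) := by
    refine (injective_iff_map_eq_zero (ContinuousLinearMap.adjoint (J y))).2 fun z hz => ?_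
    by_contra hne
    have := hneg y z hne
    rw [← ContinuousLinearMap.adjoint_inner_left, hz, inner_zero_left] at this
    exact lt_irrefl _ this
  have hsurj : Function.Surjective (J y) :=
    (LinearMap.injective_iff_surjective (f := (J y : V →ₗ[ℝ] V))).1 hinj
  have hsurj' : Function.Surjective (ContinuousLinearMap.adjoint (J y)) :=
    (LinearMap.injective_iff_surjective
      (f := (ContinuousLinearMap.adjoint (J y) : V →ₗ[ℝ] V))).1 hinj'
  obtain ⟨ζ, rfl⟩ := hsurj w
  refine ⟨ζ, fun v => ?_, rfl⟩
  -- Every test direction is `J(y)* u`, so testing `ζ` against it is testing `J(y) ζ` against `u`.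
  -- As `J(z)* u` varies continuously, upper semicontinuity of `f°` gives the bound at nearby
  -- points.
  obtain ⟨u, rfl⟩ := hsurj' v
  rw [ContinuousLinearMap.adjoint_inner_right]
  refine le_of_forall_gt_imp_ge_of_dense fun c hc => h u c ?_
  have hcont : Continuous fun z => (z, ContinuousLinearMap.adjoint (J z) u) :=
    continuous_id.prodMk
      ((ContinuousLinearMap.adjoint.continuous.comp hJ).clm_apply continuous_const)
  filter_upwards [(hcont.tendsto y).eventually (eventually_clarkeDeriv_le hf hc)] with z hz
  rintro w' ⟨ζ', hζ', rfl⟩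
  rw [← ContinuousLinearMap.adjoint_inner_right]
  exact (hζ' _).trans hz

end ClarkeField

/-! ### Matrices acting on Euclidean space -/

section MatrixAction

variable {m : ℕ}

theorem act_add_right (A : Mat m) (u v : Vec m) : act A (u + v) = act A u + act A v := map_add _ _ _

theorem act_neg_right (A : Mat m) (v : Vec m) : act A (-v) = -act A v := map_neg _ _

theorem act_add_left (A B : Mat m) (v : Vec m) : act (A + B) v = act A v + act B v := by
  simp [act]

theorem act_neg_left (A : Mat m) (v : Vec m) : act (-A) v = -act A v := by simp [act]

theorem act_sub_left (A B : Mat m) (v : Vec m) : act (A - B) v = act A v - act B v := by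
  simp [act]

theorem act_zero_left (v : Vec m) : act (0 : Mat m) v = 0 := by simp [act]

theorem act_one (v : Vec m) : act (1 : Mat m) v = v := by simp [act]

theorem act_smul_left (c : ℝ) (A : Mat m) (v : Vec m) : act (c • A) v = c • act A v := by
  simp [act]

theorem act_mul (A B : Mat m) (v : Vec m) : act (A * B) v = act A (act B v) := by
  simp [act]

theorem inner_act_left (A : Mat m) (u v : Vec m) : inner ℝ (act A u) v = inner ℝ u (act Aᵀ v) := by
  have h : Matrix.toEuclideanCLM (𝕜 := ℝ) Aᵀ =
      ContinuousLinearMap.adjoint (Matrix.toEuclideanCLM (𝕜 := ℝ) A) := by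
    rw [← ContinuousLinearMap.star_eq_adjoint, ← map_star, Matrix.star_eq_conjTranspose,
      Matrix.conjTranspose_eq_transpose_of_trivial]
  rw [act, act, h, ContinuousLinearMap.adjoint_inner_right]

theorem inner_act_right (A : Mat m) (u v : Vec m) : inner ℝ u (act A v) = inner ℝ (act Aᵀ u) v := by
  rw [inner_act_left, Matrix.transpose_transpose]

theorem act_act_inv {A : Mat m} (hA : IsUnit A) (v : Vec m) : act A (act A⁻¹ v) = v := by
  rw [← act_mul, Matrix.mul_nonsing_inv A ((Matrix.isUnit_iff_isUnit_det A).1 hA), act_one]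

theorem act_inv_act {A : Mat m} (hA : IsUnit A) (v : Vec m) : act A⁻¹ (act A v) = v := by
  rw [← act_mul, Matrix.nonsing_inv_mul A ((Matrix.isUnit_iff_isUnit_det A).1 hA), act_one]

theorem act_transpose_act_inv_transpose {A : Mat m} (hA : IsUnit A) (v : Vec m) :
    act Aᵀ (act (A⁻¹)ᵀ v) = v := by
  rw [← act_mul, ← Matrix.transpose_mul,
    Matrix.nonsing_inv_mul A ((Matrix.isUnit_iff_isUnit_det A).1 hA), Matrix.transpose_one, act_one]

theorem act_inv_transpose_act_transpose {A : Mat m} (hA : IsUnit A) (v : Vec m) :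
    act (A⁻¹)ᵀ (act Aᵀ v) = v := by
  rw [← act_mul, ← Matrix.transpose_mul,
    Matrix.mul_nonsing_inv A ((Matrix.isUnit_iff_isUnit_det A).1 hA), Matrix.transpose_one, act_one]

theorem inner_act_self_of_posDef {A : Mat m} {ε : ℝ} (hA : (A - ε • (1 : Mat m)).PosDef)
    (v : Vec m) : ε * ‖v‖ ^ 2 ≤ inner ℝ v (act A v) := by
  have h := hA.posSemidef.dotProduct_mulVec_nonneg v.ofLp
  have e : inner ℝ v (act (A - ε • (1 : Mat m)) v) =
      star v.ofLp ⬝ᵥ ((A - ε • (1 : Mat m)) *ᵥ v.ofLp) := by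
    rw [EuclideanSpace.inner_eq_star_dotProduct, dotProduct_comm, act,
      Matrix.ofLp_toEuclideanCLM]
  rw [← e, act_sub_left, act_smul_left, act_one, inner_sub_right, real_inner_smul_right,
    real_inner_self_eq_norm_sq] at h
  linarith

end MatrixAction

/-! ### Algebra of the closed loop and the gradient of `H_smc` -/

section ClosedLoop

variable {m : ℕ} {P : MechanicalPH m} {U : Vec m → ℝ} {φ : Vec m → Vec m → Vec m}

theorem MechanicalPH.isUnit_T (P : MechanicalPH m) (q : Vec m) : IsUnit (P.T q) := by
  have h1 : IsUnit (P.M q) := (P.M_posDef q).isUnit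
  have h2 : IsUnit (P.T q * (P.T q)ᵀ) := by
    rw [P.T_mul_transpose, Matrix.isUnit_nonsing_inv_iff]
    exact h1
  rw [Matrix.isUnit_iff_isUnit_det, Matrix.det_mul] at h2
  rw [Matrix.isUnit_iff_isUnit_det]
  exact isUnit_of_mul_isUnit_left h2

theorem MechanicalPH.isUnit_G (P : MechanicalPH m) (q : Vec m) : IsUnit (P.G q) := by
  have h1 : IsUnit (P.T q)ᵀ := by
    rw [Matrix.isUnit_transpose]; exact P.isUnit_T q
  exact h1.mul (P.G₀_nonsingular q)

/-- The generalized gradients `(∂φ/∂qᵀ ξ, η + ∂φ/∂ηᵀ ξ)` of `H_smc`, for `ξ ∈ ∂U(σ)`. -/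
noncomputable def gradHsmc (φ : Vec m → Vec m → Vec m) (x : State m) (ξ : Vec m) : State m :=
  WithLp.toLp 2 (act (jacQ φ x.fst x.snd)ᵀ ξ, x.snd + act (jacEta φ x.fst x.snd)ᵀ ξ)

/-- In the first row the two `ξ`-terms `T Bᵀ ξ` cancel, preserving the kinematics `q' = T η`; in the
second, `ξ` collects into `B⁻¹ Λ ξ`. -/
theorem Jsmc_gradHsmc (hq : ∀ q η, IsUnit (jacQ φ q η)) (hη : ∀ q η, IsUnit (jacEta φ q η))
    (x : State m) (ξ : Vec m) :
    P.Jsmc φ x (gradHsmc φ x ξ) = WithLp.toLp 2 (act (P.T x.fst) x.snd,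
      -act ((jacEta φ x.fst x.snd)⁻¹) (act (P.Lam φ x.fst x.snd) ξ) -
        act ((jacEta φ x.fst x.snd)⁻¹) (act (jacQ φ x.fst x.snd) (act (P.T x.fst) x.snd))) := by
  have hA := hq x.fst x.snd
  have hB := hη x.fst x.snd
  rw [MechanicalPH.Jsmc, blockAct, gradHsmc]
  simp only [MechanicalPH.Lam, act_neg_left, act_mul, act_add_left, act_add_right,
    WithLp.toLp_fst, WithLp.toLp_snd]
  rw [act_inv_transpose_act_transpose hA, act_inv_act hB]
  congr 2
  · abel
  · abel

theorem hasStrictFDerivAt_kineticEnergy (x : State m) :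
    HasStrictFDerivAt (kineticEnergy (m := m))
      ((innerSL ℝ x.snd).comp (WithLp.sndL 2 ℝ (Vec m) (Vec m))) x := by
  have h1 : HasStrictFDerivAt (fun y : State m => y.snd) (WithLp.sndL 2 ℝ (Vec m) (Vec m)) x :=
    (WithLp.sndL 2 ℝ (Vec m) (Vec m)).hasStrictFDerivAt
  have h2 := ((hasStrictFDerivAt_norm_sq x.snd).comp x h1).const_mul (1 / 2 : ℝ)
  convert! h2 using 1
  ext v
  simp

theorem gradient_kineticEnergy (x : State m) :
    gradient kineticEnergy x = WithLp.toLp 2 (0, x.snd) := by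
  refine HasGradientAt.gradient (hasGradientAt_iff_hasFDerivAt.2 ?_)
  have e : InnerProductSpace.toDual ℝ (State m) (WithLp.toLp 2 (0, x.snd)) =
      (innerSL ℝ x.snd).comp (WithLp.sndL 2 ℝ (Vec m) (Vec m)) := by
    ext1 v
    simp [WithLp.prod_inner_apply]
  rw [e]
  exact (hasStrictFDerivAt_kineticEnergy x).hasFDerivAt

/-- The input cancels `G` and the plant's damping `D`. The identity holds for every vector `ξ`, so
it serves both the smooth and the set-valued statement. -/
theorem field_feedback (hq : ∀ q η, IsUnit (jacQ φ q η)) (hη : ∀ q η, IsUnit (jacEta φ q η))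
    (x : State m) (ξ : Vec m) :
    P.field x (P.feedback φ x ξ) = P.Jsmc φ x (gradHsmc φ x ξ) := by
  rw [Jsmc_gradHsmc hq hη, MechanicalPH.field, gradient_kineticEnergy, blockAct, MechanicalPH.feedback]
  simp only [act_neg_left, act_mul, act_add_right, act_neg_right, act_sub_left, act_zero_left,
    act_act_inv (P.isUnit_G x.fst), WithLp.toLp_fst, WithLp.toLp_snd]
  rw [← WithLp.toLp_add, Prod.mk_add_mk]
  congr 2
  · simp
  · rw [show act (P.T x.fst)ᵀ (0 : Vec m) = 0 from map_zero _]
    abel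

/-- The derivative of the sliding variable `σ = φ(q, η)`. -/
noncomputable def sigmaDeriv (φ : Vec m → Vec m → Vec m) (x : State m) : State m →L[ℝ] Vec m :=
  (Matrix.toEuclideanCLM (𝕜 := ℝ) (jacQ φ x.fst x.snd)).comp (WithLp.fstL 2 ℝ (Vec m) (Vec m)) +
    (Matrix.toEuclideanCLM (𝕜 := ℝ) (jacEta φ x.fst x.snd)).comp (WithLp.sndL 2 ℝ (Vec m) (Vec m))

theorem sigmaDeriv_apply (x v : State m) :
    sigmaDeriv φ x v = act (jacQ φ x.fst x.snd) v.fst + act (jacEta φ x.fst x.snd) v.snd := rfl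

theorem toEuclideanCLM_jacQ (hφ : ContDiff ℝ 1 (fun p : Vec m × Vec m => φ p.1 p.2))
    (q η : Vec m) :
    Matrix.toEuclideanCLM (𝕜 := ℝ) (jacQ φ q η) =
      (fderiv ℝ (fun p : Vec m × Vec m => φ p.1 p.2) (q, η)).comp
        (ContinuousLinearMap.inl ℝ (Vec m) (Vec m)) := by
  rw [jacQ, StarAlgEquiv.apply_symm_apply]
  have h1 := (hφ.differentiable one_ne_zero (q, η)).hasFDerivAt
  exact (HasFDerivAt.comp (f := fun e => (e, η)) q h1 (hasFDerivAt_prodMk_left q η)).fderiv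

theorem toEuclideanCLM_jacEta (hφ : ContDiff ℝ 1 (fun p : Vec m × Vec m => φ p.1 p.2))
    (q η : Vec m) :
    Matrix.toEuclideanCLM (𝕜 := ℝ) (jacEta φ q η) =
      (fderiv ℝ (fun p : Vec m × Vec m => φ p.1 p.2) (q, η)).comp
        (ContinuousLinearMap.inr ℝ (Vec m) (Vec m)) := by
  rw [jacEta, StarAlgEquiv.apply_symm_apply]
  have h1 := (hφ.differentiable one_ne_zero (q, η)).hasFDerivAt
  exact (HasFDerivAt.comp (f := fun e => (q, e)) η h1 (hasFDerivAt_prodMk_right q η)).fderiv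

theorem hasStrictFDerivAt_sigma (hφ : ContDiff ℝ 1 (fun p : Vec m × Vec m => φ p.1 p.2))
    (x : State m) :
    HasStrictFDerivAt (fun y : State m => φ y.fst y.snd) (sigmaDeriv φ x) x := by
  have h1 : HasStrictFDerivAt (fun p : Vec m × Vec m => φ p.1 p.2)
      (fderiv ℝ (fun p : Vec m × Vec m => φ p.1 p.2) (x.fst, x.snd)) (x.fst, x.snd) :=
    hφ.contDiffAt.hasStrictFDerivAt one_ne_zero
  have h2 : HasStrictFDerivAt (fun y : State m => (y.fst, y.snd))
      ((WithLp.fstL 2 ℝ (Vec m) (Vec m)).prod (WithLp.sndL 2 ℝ (Vec m) (Vec m))) x :=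
    ((WithLp.fstL 2 ℝ (Vec m) (Vec m)).prod (WithLp.sndL 2 ℝ (Vec m) (Vec m))).hasStrictFDerivAt
  convert! HasStrictFDerivAt.comp x h1 h2 using 1
  ext1 v
  rw [sigmaDeriv, toEuclideanCLM_jacQ hφ, toEuclideanCLM_jacEta hφ]
  simp only [_root_.add_apply, ContinuousLinearMap.comp_apply]
  rw [← map_add]
  simp

theorem sigmaDeriv_surjective (hq : ∀ q η, IsUnit (jacQ φ q η)) (x : State m) :
    Function.Surjective (sigmaDeriv φ x) := fun w => by
  refine ⟨WithLp.toLp 2 (act (jacQ φ x.fst x.snd)⁻¹ w, 0), ?_⟩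
  simp only [sigmaDeriv_apply, WithLp.toLp_fst, WithLp.toLp_snd]
  rw [act_act_inv (hq _ _)]
  simp [act]

theorem Hsmc_eq (U : Vec m → ℝ) (φ : Vec m → Vec m → Vec m) :
    Hsmc U φ = fun x => kineticEnergy x + U (φ x.fst x.snd) := rfl

theorem inner_gradHsmc (x v : State m) (ξ : Vec m) :
    inner ℝ (gradHsmc φ x ξ) v = inner ℝ x.snd v.snd + inner ℝ ξ (sigmaDeriv φ x v) := by
  rw [WithLp.prod_inner_apply, sigmaDeriv_apply, inner_add_right, inner_act_right, inner_act_right,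
    gradHsmc]
  simp only [WithLp.ofLp_fst, WithLp.ofLp_snd, inner_add_left]
  ring

theorem gradient_Hsmc (hφ : ContDiff ℝ 1 (fun p : Vec m × Vec m => φ p.1 p.2)) (x : State m)
    (hU : DifferentiableAt ℝ U (φ x.fst x.snd)) :
    gradient (Hsmc U φ) x = gradHsmc φ x (gradient U (φ x.fst x.snd)) := by
  refine HasGradientAt.gradient (hasGradientAt_iff_hasFDerivAt.2 ?_)
  have h1 := hU.hasGradientAt.hasFDerivAt
  have h2 := (hasStrictFDerivAt_kineticEnergy x).hasFDerivAt.add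
    (HasFDerivAt.comp x h1 (hasStrictFDerivAt_sigma hφ x).hasFDerivAt)
  have e : InnerProductSpace.toDual ℝ (State m) (gradHsmc φ x (gradient U (φ x.fst x.snd))) =
      (innerSL ℝ x.snd).comp (WithLp.sndL 2 ℝ (Vec m) (Vec m)) +
        (InnerProductSpace.toDual ℝ (Vec m) (gradient U (φ x.fst x.snd))).comp
          (sigmaDeriv φ x) := by
    ext1 v
    rw [InnerProductSpace.toDual_apply_apply, inner_gradHsmc]
    rfl
  rw [e]
  exact h2

theorem clarkeDeriv_Hsmc (hφ : ContDiff ℝ 1 (fun p : Vec m × Vec m => φ p.1 p.2))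
    (hq : ∀ q η, IsUnit (jacQ φ q η)) (hU : LocallyLipschitz U) (x v : State m) :
    clarkeDeriv (Hsmc U φ) x v =
      inner ℝ x.snd v.snd + clarkeDeriv U (φ x.fst x.snd) (sigmaDeriv φ x v) := by
  have := clarkeDeriv_add_comp hU (hasStrictFDerivAt_kineticEnergy x)
    (hasStrictFDerivAt_sigma hφ x) (sigmaDeriv_surjective hq x) v
  rw [Hsmc_eq, this]
  rfl

/-- The only candidate is `ξ = A⁻ᵀ ζ_q`. Moving `q` alone realizes every velocity of `σ` and shows
`ξ ∈ ∂U(σ)`; moving along the kernel of the derivative of `σ` determines the `η`-component. -/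
theorem clarkeGradient_Hsmc (hφ : ContDiff ℝ 1 (fun p : Vec m × Vec m => φ p.1 p.2))
    (hq : ∀ q η, IsUnit (jacQ φ q η)) (hU : LocallyLipschitz U) (x : State m) :
    clarkeGradient (Hsmc U φ) x = gradHsmc φ x '' clarkeGradient U (φ x.fst x.snd) := by
  ext ζ
  constructor
  · intro hζ
    set A := jacQ φ x.fst x.snd with hA
    set B := jacEta φ x.fst x.snd with hB
    have hAu : IsUnit A := hq _ _
    have hz : ∀ v : State m, inner ℝ ζ.fst v.fst + inner ℝ ζ.snd v.snd ≤ inner ℝ x.snd v.snd +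
        clarkeDeriv U (φ x.fst x.snd) (act A v.fst + act B v.snd) := by
      intro v
      have := hζ v
      rw [clarkeDeriv_Hsmc hφ hq hU, sigmaDeriv_apply, WithLp.prod_inner_apply] at this
      exact this
    refine ⟨act (A⁻¹)ᵀ ζ.fst, fun w => ?_, ?_⟩
    · have := hz (WithLp.toLp 2 (act A⁻¹ w, 0))
      simp only [WithLp.toLp_fst, WithLp.toLp_snd, inner_zero_right, add_zero, zero_add] at this
      rw [act_act_inv hAu, show act B (0 : Vec m) = 0 from map_zero _, add_zero] at this
      rwa [inner_act_left, Matrix.transpose_transpose]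
    · have hker : ∀ w : Vec m, inner ℝ (ζ.snd - x.snd - act Bᵀ (act (A⁻¹)ᵀ ζ.fst)) w ≤ 0 := by
        intro w
        -- This direction leaves `σ` fixed to first order, so `U°` contributes nothing and a linear
        -- form in `w` is nonpositive, hence zero.
        have := hz (WithLp.toLp 2 (-act A⁻¹ (act B w), w))
        simp only [WithLp.toLp_fst, WithLp.toLp_snd] at this
        rw [act_neg_right, act_act_inv hAu, neg_add_cancel, clarkeDeriv_zero_right,
          inner_neg_right] at this
        rw [inner_sub_left, inner_sub_left, inner_act_left, Matrix.transpose_transpose,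
          inner_act_left, Matrix.transpose_transpose]
        linarith
      have h0 : ζ.snd - x.snd - act Bᵀ (act (A⁻¹)ᵀ ζ.fst) = 0 :=
        inner_self_eq_zero.1 (le_antisymm (hker _) real_inner_self_nonneg)
      rw [gradHsmc, ← hA, ← hB, act_transpose_act_inv_transpose hAu]
      have h2 : x.snd + act Bᵀ (act (A⁻¹)ᵀ ζ.fst) = ζ.snd := by
        rw [sub_sub, sub_eq_zero] at h0
        exact h0.symm
      rw [h2]
      rfl
  · rintro ⟨ξ, hξ, rfl⟩ v
    rw [clarkeDeriv_Hsmc hφ hq hU, inner_gradHsmc]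
    gcongr
    exact hξ _

/-- Along the closed loop the sliding variable obeys `σ' = -Λ ξ`. -/
theorem sigmaDeriv_Jsmc (hq : ∀ q η, IsUnit (jacQ φ q η)) (hη : ∀ q η, IsUnit (jacEta φ q η))
    (x : State m) (ξ : Vec m) :
    sigmaDeriv φ x (P.Jsmc φ x (gradHsmc φ x ξ)) = -act (P.Lam φ x.fst x.snd) ξ := by
  rw [Jsmc_gradHsmc hq hη]
  simp only [sigmaDeriv_apply, WithLp.toLp_fst, WithLp.toLp_snd, sub_eq_add_neg, act_add_right,
    act_neg_right, act_act_inv (hη x.fst x.snd)]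
  abel

/-- The two summands of `Λ` are transposes of each other and have the same quadratic form. -/
theorem inner_act_Lam (x : State m) (a : Vec m) :
    inner ℝ a (act (P.Lam φ x.fst x.snd) a) = 2 * inner ℝ a (act (jacQ φ x.fst x.snd)
      (act (P.T x.fst) (act (jacEta φ x.fst x.snd)ᵀ a))) := by
  simp only [MechanicalPH.Lam, act_add_left, act_mul, inner_add_right]
  have : inner ℝ a (act (jacEta φ x.fst x.snd) (act (P.T x.fst)ᵀ (act (jacQ φ x.fst x.snd)ᵀ a))) =
      inner ℝ a (act (jacQ φ x.fst x.snd) (act (P.T x.fst) (act (jacEta φ x.fst x.snd)ᵀ a))) := by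
    rw [inner_act_right, inner_act_right, inner_act_right, real_inner_comm]
    simp only [Matrix.transpose_transpose]
  rw [this]; ring

/-- The quadratic form of `J_smc`. -/
theorem inner_Jsmc_self (hq : ∀ q η, IsUnit (jacQ φ q η))
    (hη : ∀ q η, IsUnit (jacEta φ q η)) (x : State m) (a b : Vec m) :
    inner ℝ (WithLp.toLp 2 (act (jacQ φ x.fst x.snd)ᵀ a, act (jacEta φ x.fst x.snd)ᵀ b) : State m)
      (P.Jsmc φ x (WithLp.toLp 2 (act (jacQ φ x.fst x.snd)ᵀ a, act (jacEta φ x.fst x.snd)ᵀ b))) =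
      -(inner ℝ a (act (P.Lam φ x.fst x.snd) a) / 2) -
        inner ℝ b (act (P.Lam φ x.fst x.snd) b) / 2 := by
  rw [inner_act_Lam, inner_act_Lam, WithLp.prod_inner_apply, MechanicalPH.Jsmc, blockAct]
  simp only [WithLp.toLp_fst, WithLp.toLp_snd, act_neg_left, act_mul, inner_add_right,
    inner_neg_right, act_inv_transpose_act_transpose (hq x.fst x.snd)]
  have h1 : inner ℝ (act (jacQ φ x.fst x.snd)ᵀ a) (act (P.T x.fst) (act (jacEta φ x.fst x.snd)ᵀ a)) =
      inner ℝ a (act (jacQ φ x.fst x.snd) (act (P.T x.fst) (act (jacEta φ x.fst x.snd)ᵀ a))) := by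
    rw [inner_act_left, Matrix.transpose_transpose]
  -- The off-diagonal blocks `T` and `-Tᵀ` are skew, so their contributions cancel.
  have h2 : inner ℝ (act (jacEta φ x.fst x.snd)ᵀ b) (act (P.T x.fst)ᵀ (act (jacQ φ x.fst x.snd)ᵀ a)) =
      inner ℝ (act (jacQ φ x.fst x.snd)ᵀ a) (act (P.T x.fst) (act (jacEta φ x.fst x.snd)ᵀ b)) := by
    rw [← inner_act_left, real_inner_comm]
  have h3 : inner ℝ (act (jacEta φ x.fst x.snd)ᵀ b) (act (jacEta φ x.fst x.snd)⁻¹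
      (act (jacQ φ x.fst x.snd) (act (P.T x.fst) (act (jacEta φ x.fst x.snd)ᵀ b)))) =
      inner ℝ b (act (jacQ φ x.fst x.snd) (act (P.T x.fst) (act (jacEta φ x.fst x.snd)ᵀ b))) := by
    rw [inner_act_right, act_inv_transpose_act_transpose (hη x.fst x.snd)]
  rw [h1, h2, h3]
  ring

end ClosedLoop

/-! ### Continuity of `J_smc` and the energy balance -/

section Dissipation

variable {m : ℕ} {P : MechanicalPH m} {U : Vec m → ℝ} {φ : Vec m → Vec m → Vec m}

theorem continuous_toEuclideanCLM :
    Continuous (Matrix.toEuclideanCLM (n := Fin m) (𝕜 := ℝ)) :=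
  LinearMap.continuous_of_finiteDimensional
    (Matrix.toEuclideanCLM (n := Fin m) (𝕜 := ℝ)).toAlgEquiv.toLinearMap

theorem continuous_toEuclideanCLM_symm :
    Continuous (Matrix.toEuclideanCLM (n := Fin m) (𝕜 := ℝ)).symm :=
  LinearMap.continuous_of_finiteDimensional
    (Matrix.toEuclideanCLM (n := Fin m) (𝕜 := ℝ)).symm.toAlgEquiv.toLinearMap

theorem _root_.Continuous.matrix_nonsing_inv {X : Type*} [TopologicalSpace X] {A : X → Mat m}
    (hA : Continuous A) (hu : ∀ x, IsUnit (A x)) : Continuous fun x => (A x)⁻¹ := by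
  simp only [Matrix.inv_def, Ring.inverse_eq_inv']
  refine (hA.matrix_det.inv₀ fun x => ?_).smul hA.matrix_adjugate
  exact ((Matrix.isUnit_iff_isUnit_det _).1 (hu x)).ne_zero

theorem continuous_fderiv_phi (hφ : ContDiff ℝ 1 (fun p : Vec m × Vec m => φ p.1 p.2)) :
    Continuous fun x : State m => fderiv ℝ (fun p : Vec m × Vec m => φ p.1 p.2) (x.fst, x.snd) :=
  (hφ.continuous_fderiv one_ne_zero).comp (by fun_prop)

theorem continuous_jacQ (hφ : ContDiff ℝ 1 (fun p : Vec m × Vec m => φ p.1 p.2)) :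
    Continuous fun x : State m => jacQ φ x.fst x.snd := by
  have h : ∀ x : State m, jacQ φ x.fst x.snd = (Matrix.toEuclideanCLM (𝕜 := ℝ)).symm
      ((fderiv ℝ (fun p : Vec m × Vec m => φ p.1 p.2) (x.fst, x.snd)).comp
        (ContinuousLinearMap.inl ℝ (Vec m) (Vec m))) := fun x => by
    rw [← toEuclideanCLM_jacQ hφ, StarAlgEquiv.symm_apply_apply]
  simp only [h]
  exact continuous_toEuclideanCLM_symm.comp
    ((continuous_fderiv_phi hφ).clm_comp continuous_const)

theorem continuous_jacEta (hφ : ContDiff ℝ 1 (fun p : Vec m × Vec m => φ p.1 p.2)) :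
    Continuous fun x : State m => jacEta φ x.fst x.snd := by
  have h : ∀ x : State m, jacEta φ x.fst x.snd = (Matrix.toEuclideanCLM (𝕜 := ℝ)).symm
      ((fderiv ℝ (fun p : Vec m × Vec m => φ p.1 p.2) (x.fst, x.snd)).comp
        (ContinuousLinearMap.inr ℝ (Vec m) (Vec m))) := fun x => by
    rw [← toEuclideanCLM_jacEta hφ, StarAlgEquiv.symm_apply_apply]
  simp only [h]
  exact continuous_toEuclideanCLM_symm.comp
    ((continuous_fderiv_phi hφ).clm_comp continuous_const)

/-- `blockAct` as a continuous linear map. -/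
noncomputable def blockCLM (A B C D : Mat m) : State m →L[ℝ] State m :=
  ((WithLp.prodContinuousLinearEquiv 2 ℝ (Vec m) (Vec m)).symm : Vec m × Vec m →L[ℝ] State m).comp
    (((Matrix.toEuclideanCLM (𝕜 := ℝ) A).comp (WithLp.fstL 2 ℝ (Vec m) (Vec m)) +
      (Matrix.toEuclideanCLM (𝕜 := ℝ) B).comp (WithLp.sndL 2 ℝ (Vec m) (Vec m))).prod
    ((Matrix.toEuclideanCLM (𝕜 := ℝ) C).comp (WithLp.fstL 2 ℝ (Vec m) (Vec m)) +
      (Matrix.toEuclideanCLM (𝕜 := ℝ) D).comp (WithLp.sndL 2 ℝ (Vec m) (Vec m))))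

theorem _root_.Continuous.blockCLM {X : Type*} [TopologicalSpace X] {A B C D : X → Mat m}
    (hA : Continuous A) (hB : Continuous B) (hC : Continuous C) (hD : Continuous D) :
    Continuous fun x => blockCLM (A x) (B x) (C x) (D x) := by
  have hE := continuous_toEuclideanCLM (m := m)
  refine continuous_const.clm_comp ?_
  have h1 : Continuous fun x =>
      (Matrix.toEuclideanCLM (𝕜 := ℝ) (A x)).comp (WithLp.fstL 2 ℝ (Vec m) (Vec m)) +
      (Matrix.toEuclideanCLM (𝕜 := ℝ) (B x)).comp (WithLp.sndL 2 ℝ (Vec m) (Vec m)) :=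
    ((hE.comp hA).clm_comp continuous_const).add ((hE.comp hB).clm_comp continuous_const)
  have h2 : Continuous fun x =>
      (Matrix.toEuclideanCLM (𝕜 := ℝ) (C x)).comp (WithLp.fstL 2 ℝ (Vec m) (Vec m)) +
      (Matrix.toEuclideanCLM (𝕜 := ℝ) (D x)).comp (WithLp.sndL 2 ℝ (Vec m) (Vec m)) :=
    ((hE.comp hC).clm_comp continuous_const).add ((hE.comp hD).clm_comp continuous_const)
  exact (ContinuousLinearMap.prodₗᵢ (𝕜 := ℝ) ℝ).continuous.comp (h1.prodMk h2)

/-- The structure matrix `J_smc` as a continuous linear map. -/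
noncomputable def JsmcCLM (P : MechanicalPH m) (φ : Vec m → Vec m → Vec m) (x : State m) :
    State m →L[ℝ] State m :=
  blockCLM
    (-(P.T x.fst * (jacEta φ x.fst x.snd)ᵀ * ((jacQ φ x.fst x.snd)⁻¹)ᵀ)) (P.T x.fst)
    (-(P.T x.fst)ᵀ) (-((jacEta φ x.fst x.snd)⁻¹ * jacQ φ x.fst x.snd * P.T x.fst))

theorem JsmcCLM_apply (x z : State m) : JsmcCLM P φ x z = P.Jsmc φ x z := rfl

theorem continuous_JsmcCLM (hφ : ContDiff ℝ 1 (fun p : Vec m × Vec m => φ p.1 p.2))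
    (hq : ∀ q η, IsUnit (jacQ φ q η)) (hη : ∀ q η, IsUnit (jacEta φ q η)) :
    Continuous (JsmcCLM P φ) := by
  have hA := continuous_jacQ hφ
  have hB := continuous_jacEta hφ
  have hT : Continuous fun x : State m => P.T x.fst := P.T_continuous.comp (by fun_prop)
  have hAi := hA.matrix_nonsing_inv fun x => hq _ _
  have hBi := hB.matrix_nonsing_inv fun x => hη _ _
  exact Continuous.blockCLM ((hT.matrix_mul hB.matrix_transpose).matrix_mul hAi.matrix_transpose).neg
    hT hT.matrix_transpose.neg ((hBi.matrix_mul hA).matrix_mul hT).neg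

/-- Invertible Jacobians write every `z` as `(Aᵀa, Bᵀb)`, on which the form is minus half the sum of
the `Λ`-forms of `a` and `b`. -/
theorem inner_JsmcCLM_neg (hq : ∀ q η, IsUnit (jacQ φ q η)) (hη : ∀ q η, IsUnit (jacEta φ q η))
    {ε : ℝ} (hε : 0 < ε) (hΛ : ∀ q η, (P.Lam φ q η - ε • (1 : Mat m)).PosDef)
    (x z : State m) (hz : z ≠ 0) : inner ℝ z (JsmcCLM P φ x z) < 0 := by
  set a := act ((jacQ φ x.fst x.snd)⁻¹)ᵀ z.fst with ha
  set b := act ((jacEta φ x.fst x.snd)⁻¹)ᵀ z.snd with hb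
  have h1 : act (jacQ φ x.fst x.snd)ᵀ a = z.fst := act_transpose_act_inv_transpose (hq _ _) _
  have h2 : act (jacEta φ x.fst x.snd)ᵀ b = z.snd := act_transpose_act_inv_transpose (hη _ _) _
  have h3 := inner_Jsmc_self (P := P) hq hη x a b
  rw [h1, h2] at h3
  have e : (WithLp.toLp 2 (z.fst, z.snd) : State m) = z := rfl
  rw [e] at h3
  rw [JsmcCLM_apply, h3]
  have h4 := inner_act_self_of_posDef (hΛ x.fst x.snd) a
  have h5 := inner_act_self_of_posDef (hΛ x.fst x.snd) b
  have h6 : 0 < ‖a‖ ^ 2 + ‖b‖ ^ 2 := by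
    by_contra! hcon
    have ha0 : ‖a‖ ^ 2 = 0 := by nlinarith [sq_nonneg ‖a‖, sq_nonneg ‖b‖]
    have hb0 : ‖b‖ ^ 2 = 0 := by nlinarith [sq_nonneg ‖a‖, sq_nonneg ‖b‖]
    have ha1 : a = 0 := by simpa using ha0
    have hb1 : b = 0 := by simpa using hb0
    apply hz
    rw [← e, ← h1, ← h2, ha1, hb1]
    simp [act]
  nlinarith

theorem locallyLipschitz_sigma (hφ : ContDiff ℝ 1 (fun p : Vec m × Vec m => φ p.1 p.2)) :
    LocallyLipschitz fun x : State m => φ x.fst x.snd := by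
  have h : ContDiff ℝ 1 (fun x : State m => (x.fst, x.snd)) :=
    ((WithLp.fstL 2 ℝ (Vec m) (Vec m)).prod (WithLp.sndL 2 ℝ (Vec m) (Vec m))).contDiff
  exact (hφ.comp h).locallyLipschitz

theorem locallyLipschitz_Hsmc (hφ : ContDiff ℝ 1 (fun p : Vec m × Vec m => φ p.1 p.2))
    (hU : LocallyLipschitz U) : LocallyLipschitz (Hsmc U φ) := by
  have h1 : ContDiff ℝ 1 (kineticEnergy (m := m)) :=
    contDiff_const.mul ((WithLp.sndL 2 ℝ (Vec m) (Vec m)).contDiff.norm_sq ℝ)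
  exact h1.locallyLipschitz.add (hU.comp (locallyLipschitz_sigma hφ))

/-- Energy balance: along almost every point of a solution, both the potential and the closed-loop
Hamiltonian are dissipated through quadratic forms of `Λ`. -/
theorem ae_dissipation (hφ : ContDiff ℝ 1 (fun p : Vec m × Vec m => φ p.1 p.2))
    (hq : ∀ q η, IsUnit (jacQ φ q η)) (hη : ∀ q η, IsUnit (jacEta φ q η))
    (hU : AdmissiblePotential U) {x : ℝ → State m} {τ : EReal}
    (hx : IsSolution (P.closedLoop U φ) x τ) :
    ∀ᵐ t : ℝ, 0 < t → (t : EReal) < τ → ∃ ξ ∈ clarkeGradient U (φ (x t).fst (x t).snd), ∃ p : Vec m,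
      act (jacEta φ (x t).fst (x t).snd)ᵀ p =
        (x t).snd + act (jacEta φ (x t).fst (x t).snd)ᵀ ξ ∧
      HasDerivAt (fun s => U (φ (x s).fst (x s).snd))
        (-inner ℝ ξ (act (P.Lam φ (x t).fst (x t).snd) ξ)) t ∧
      HasDerivAt (fun s => Hsmc U φ (x s))
        (-(inner ℝ ξ (act (P.Lam φ (x t).fst (x t).snd) ξ) / 2) -
          inner ℝ p (act (P.Lam φ (x t).fst (x t).snd) p) / 2) t := by
  have hac : ∀ b : ℝ, 0 < b → (b : EReal) < τ →
      AbsolutelyContinuousOnInterval (fun s => φ (x s).fst (x s).snd) 0 b := fun b h0 hb =>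
    (locallyLipschitz_sigma hφ).comp_absolutelyContinuousOnInterval (hx.1 b h0 hb)
  filter_upwards [hx.2, hU.ae_hasDerivAt_comp hac] with t h1 h2 h0 hτ
  obtain ⟨w, hw, hd⟩ := h1 h0 hτ
  obtain ⟨ζ, hζ, rfl⟩ := hw
  rw [clarkeGradient_Hsmc hφ hq hU.1] at hζ
  obtain ⟨ξ, hξ, rfl⟩ := hζ
  have hσ : HasDerivAt (fun s => φ (x s).fst (x s).snd)
      (sigmaDeriv φ (x t) (P.Jsmc φ (x t) (gradHsmc φ (x t) ξ))) t :=
    (hasStrictFDerivAt_sigma hφ (x t)).hasFDerivAt.comp_hasDerivAt t hd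
  have hUd := h2 h0 hτ _ hσ ξ hξ
  have hK : HasDerivAt (fun s => kineticEnergy (x s))
      (inner ℝ (x t).snd (P.Jsmc φ (x t) (gradHsmc φ (x t) ξ)).snd) t :=
    (hasStrictFDerivAt_kineticEnergy (x t)).hasFDerivAt.comp_hasDerivAt t hd
  -- Chosen so that the gradient becomes `(Aᵀξ, Bᵀp)`, the shape in which the form of `J_smc`
  -- diagonalizes.
  set p := act ((jacEta φ (x t).fst (x t).snd)⁻¹)ᵀ
    ((x t).snd + act (jacEta φ (x t).fst (x t).snd)ᵀ ξ) with hp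
  have hp' : act (jacEta φ (x t).fst (x t).snd)ᵀ p =
      (x t).snd + act (jacEta φ (x t).fst (x t).snd)ᵀ ξ := act_transpose_act_inv_transpose (hη _ _) _
  refine ⟨ξ, hξ, p, hp', ?_, ?_⟩
  · rw [sigmaDeriv_Jsmc hq hη, inner_neg_right] at hUd
    exact hUd
  · have hsum := hK.add hUd
    rw [← inner_gradHsmc] at hsum
    have h3 := inner_Jsmc_self (P := P) hq hη (x t) ξ p
    rw [hp'] at h3
    rw [← h3]
    exact hsum

end Dissipation

/-! ### Reaching time, strict Lyapunov property and attractivity -/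

section Main

variable {m : ℕ} {P : MechanicalPH m} {U : Vec m → ℝ} {φ : Vec m → Vec m → Vec m} {ε : ℝ}

theorem Hsmc_le_of_isSolution (hφ : ContDiff ℝ 1 (fun p : Vec m × Vec m => φ p.1 p.2))
    (hq : ∀ q η, IsUnit (jacQ φ q η)) (hη : ∀ q η, IsUnit (jacEta φ q η))
    (hU : AdmissiblePotential U) (hε : 0 < ε)
    (hΛ : ∀ q η, (P.Lam φ q η - ε • (1 : Mat m)).PosDef) (τ : EReal) (x : ℝ → State m)
    (hx : IsSolution (P.closedLoop U φ) x τ) (s t : ℝ) (hs : 0 ≤ s) (hst : s ≤ t)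
    (ht : (t : EReal) < τ) : Hsmc U φ (x t) ≤ Hsmc U φ (x s) := by
  rcases hst.eq_or_lt with rfl | hlt
  · exact le_rfl
  have hac := (locallyLipschitz_Hsmc hφ hU.1).comp_absolutelyContinuousOnInterval
    (hx.1 t (hs.trans_lt hlt) ht)
  refine (hac.mono (c := s) (d := t) ?_).le_of_ae_deriv_nonpos hst ?_
  · rw [Set.uIcc_of_le hst, Set.uIcc_of_le (hs.trans hst)]
    exact Set.Icc_subset_Icc hs le_rfl
  · filter_upwards [ae_dissipation hφ hq hη hU hx] with r hr hrm
    obtain ⟨ξ, -, p, -, -, hd⟩ := hr (hs.trans_lt hrm.1)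
      ((EReal.coe_lt_coe_iff.2 hrm.2).trans ht)
    refine ⟨_, ?_, hd⟩
    have h1 := inner_act_self_of_posDef (hΛ (x r).fst (x r).snd) ξ
    have h2 := inner_act_self_of_posDef (hΛ (x r).fst (x r).snd) p
    have h3 : 0 ≤ ε * ‖ξ‖ ^ 2 := by positivity
    have h4 : 0 ≤ ε * ‖p‖ ^ 2 := by positivity
    linarith

/-- The sliding variable vanishes after a finite time. -/
theorem exists_reaching_time (hφ : ContDiff ℝ 1 (fun p : Vec m × Vec m => φ p.1 p.2))
    (hq : ∀ q η, IsUnit (jacQ φ q η)) (hη : ∀ q η, IsUnit (jacEta φ q η))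
    (hU : AdmissiblePotential U) (hε : 0 < ε)
    (hΛ : ∀ q η, (P.Lam φ q η - ε • (1 : Mat m)).PosDef)
    (hU0 : U 0 = 0) (hUpos : ∀ σ, σ ≠ 0 → 0 < U σ) {c ρ : ℝ} (hc : 0 < c) (hρ : ρ < 1 / 2)
    (hL : ∀ σ, σ ≠ 0 → ∀ ξ ∈ clarkeGradient U σ, c * U σ ^ ρ ≤ ‖ξ‖) (x₀ : State m) :
    ∃ ts : ℝ, 0 ≤ ts ∧ ∀ (τ : EReal) (x : ℝ → State m), x 0 = x₀ →
      IsSolution (P.closedLoop U φ) x τ →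
      ∀ t : ℝ, ts ≤ t → (t : EReal) < τ → φ (x t).fst (x t).snd = 0 := by
  have hUnn : ∀ σ, 0 ≤ U σ := fun σ => by
    by_cases h : σ = 0
    · rw [h, hU0]
    · exact (hUpos σ h).le
  set k := ε * c ^ 2 with hk
  have hk0 : 0 < k := by positivity
  have hα : 0 < 1 - 2 * ρ := by linarith
  -- The extinction time of `u' = -k u^(2ρ)`; `k = ε c²` combines `Λ ≻ ε I` with `‖ξ‖ ≥ c U^ρ`. It
  -- depends on the initial state only.
  set ts := U (φ x₀.fst x₀.snd) ^ (1 - 2 * ρ) / (k * (1 - 2 * ρ)) with hts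
  have hts0 : 0 ≤ ts := div_nonneg (Real.rpow_nonneg (hUnn _) _) (by positivity)
  refine ⟨ts, hts0, fun τ x hx0 hx t ht hτ => ?_⟩
  have ht0 : 0 ≤ t := hts0.trans ht
  have hac : AbsolutelyContinuousOnInterval (fun s => U (φ (x s).fst (x s).snd)) 0 t := by
    rcases ht0.eq_or_lt with rfl | h0
    · have hsub : LipschitzOnWith 0 (fun s => U (φ (x s).fst (x s).snd)) (Set.uIcc 0 0) := by
        rw [Set.uIcc_self]
        intro a ha b hb
        rw [Set.mem_singleton_iff.1 ha, Set.mem_singleton_iff.1 hb]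
        simp
      exact hsub.absolutelyContinuousOnInterval
    · exact (hU.1.comp (locallyLipschitz_sigma hφ)).comp_absolutelyContinuousOnInterval
        (hx.1 t h0 hτ)
  have hzero : U (φ (x t).fst (x t).snd) = 0 := by
    refine eq_zero_of_ae_deriv_le_neg_rpow (g := fun s => U (φ (x s).fst (x s).snd)) hk0 hρ ht0 hac
      (fun s => hUnn _) ?_ ?_
    · filter_upwards [ae_dissipation hφ hq hη hU hx] with s hs hsm
      obtain ⟨ξ, hξ, p, -, hd, -⟩ := hs hsm.1 ((EReal.coe_lt_coe_iff.2 hsm.2).trans hτ)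
      have h1 := inner_act_self_of_posDef (hΛ (x s).fst (x s).snd) ξ
      have h2 : 0 ≤ ε * ‖ξ‖ ^ 2 := by positivity
      refine ⟨_, by linarith, fun hpos => ?_, hd⟩
      have hne : φ (x s).fst (x s).snd ≠ 0 := by
        intro h
        rw [h, hU0] at hpos
        exact lt_irrefl _ hpos
      have h3 := hL _ hne ξ hξ
      have h4 : (c * U (φ (x s).fst (x s).snd) ^ ρ) ^ 2 ≤ ‖ξ‖ ^ 2 :=
        pow_le_pow_left₀ (mul_nonneg hc.le (Real.rpow_nonneg (hUnn _) _)) h3 2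
      have h5 := mul_le_mul_of_nonneg_left h4 hε.le
      have h6 : k * (U (φ (x s).fst (x s).snd) ^ ρ) ^ 2 =
          ε * (c * U (φ (x s).fst (x s).snd) ^ ρ) ^ 2 := by rw [hk]; ring
      rw [h6]
      linarith
    · simpa only [hx0] using ht
  by_contra hne
  exact (hUpos _ hne).ne' hzero

/-- The sliding surface meets `η = 0` near the origin only at the origin. -/
theorem exists_ball_phi_ne_zero (hφ : ContDiff ℝ 1 (fun p : Vec m × Vec m => φ p.1 p.2))
    (hq : ∀ q η, IsUnit (jacQ φ q η)) :
    ∃ r > 0, ∀ q : Vec m, ‖q‖ ≤ r → q ≠ 0 → φ q 0 ≠ 0 := by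
  have hd : HasFDerivAt (fun q => φ q 0) (Matrix.toEuclideanCLM (𝕜 := ℝ) (jacQ φ 0 0)) 0 := by
    rw [toEuclideanCLM_jacQ hφ]
    exact HasFDerivAt.comp (f := fun e => (e, (0 : Vec m))) 0
      (hφ.differentiable one_ne_zero (0, 0)).hasFDerivAt (hasFDerivAt_prodMk_left 0 0)
  -- An invertible derivative of `q ↦ φ q 0` keeps the function from taking the value `0` at other
  -- points near the origin.
  have hinv : ∃ C, AntilipschitzWith C (Matrix.toEuclideanCLM (𝕜 := ℝ) (jacQ φ 0 0)) := by
    refine ⟨‖Matrix.toEuclideanCLM (𝕜 := ℝ) (jacQ φ 0 0)⁻¹‖₊,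
      AddMonoidHomClass.antilipschitz_of_bound _ fun z => ?_⟩
    have := (Matrix.toEuclideanCLM (𝕜 := ℝ) (jacQ φ 0 0)⁻¹).le_opNorm
      (Matrix.toEuclideanCLM (𝕜 := ℝ) (jacQ φ 0 0) z)
    rwa [show Matrix.toEuclideanCLM (𝕜 := ℝ) (jacQ φ 0 0)⁻¹
      (Matrix.toEuclideanCLM (𝕜 := ℝ) (jacQ φ 0 0) z) = z from act_inv_act (hq 0 0) z] at this
  have hev := hd.eventually_ne hinv (c := (0 : Vec m))
  rw [eventually_nhdsWithin_iff, Metric.eventually_nhds_iff] at hev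
  obtain ⟨δ, hδ, h⟩ := hev
  refine ⟨δ / 2, by positivity, fun q hq' hne => h (y := q) ?_ hne⟩
  rw [dist_zero_right]
  linarith

theorem Hsmc_pos (hUpos : ∀ σ, σ ≠ 0 → 0 < U σ) (hU0 : U 0 = 0) {r : ℝ}
    (hr : ∀ q : Vec m, ‖q‖ ≤ r → q ≠ 0 → φ q 0 ≠ 0) (x : State m) (hx : ‖x‖ ≤ r) (hne : x ≠ 0) :
    0 < Hsmc U φ x := by
  have hUnn : 0 ≤ U (φ x.fst x.snd) := by
    by_cases h : φ x.fst x.snd = 0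
    · rw [h, hU0]
    · exact (hUpos _ h).le
  by_cases h : x.snd = 0
  · have hq : x.fst ≠ 0 := by
      intro h'
      apply hne
      rw [show x = WithLp.toLp 2 (x.fst, x.snd) from rfl, h, h']
      rfl
    have h1 := hUpos _ (hr x.fst ((WithLp.norm_fst_le (Vec m) x).trans hx) hq)
    rw [Hsmc, h]
    simpa using h1
  · have : 0 < ‖x.snd‖ := norm_pos_iff.2 h
    rw [Hsmc]
    positivity

/-- Zero dissipation means `ξ = p = 0`, so `η = 0`. If `q ≠ 0` is small then `σ ≠ 0`, and the
gradient inequality excludes `ξ = 0`. -/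
theorem isStrictLyapunovFunction_Hsmc
    (hφ : ContDiff ℝ 1 (fun p : Vec m × Vec m => φ p.1 p.2)) (hφ0 : φ 0 0 = 0)
    (hq : ∀ q η, IsUnit (jacQ φ q η)) (hη : ∀ q η, IsUnit (jacEta φ q η))
    (hU : AdmissiblePotential U) (hε : 0 < ε)
    (hΛ : ∀ q η, (P.Lam φ q η - ε • (1 : Mat m)).PosDef)
    (hU0 : U 0 = 0) (hUpos : ∀ σ, σ ≠ 0 → 0 < U σ) {c ρ : ℝ} (hc : 0 < c)
    (hL : ∀ σ, σ ≠ 0 → ∀ ξ ∈ clarkeGradient U σ, c * U σ ^ ρ ≤ ‖ξ‖) :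
    IsStrictLyapunovFunction (P.closedLoop U φ) (Hsmc U φ) := by
  obtain ⟨r, hr, hrφ⟩ := exists_ball_phi_ne_zero hφ hq
  have hlip := locallyLipschitz_Hsmc hφ hU.1
  refine ⟨by simp [Hsmc, hφ0, hU0], r, hr, hlip.continuous.continuousOn,
    fun x hx => Hsmc_pos hUpos hU0 hrφ x (by simpa using (Metric.ball_subset_closedBall hx)),
    fun τ x hx hball => ?_⟩
  have hae : ∀ᵐ t : ℝ, 0 < t → (t : EReal) < τ → x t ≠ 0 →
      ∃ d < 0, HasDerivAt (fun s => Hsmc U φ (x s)) d t := by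
    filter_upwards [ae_dissipation hφ hq hη hU hx] with t ht h0 hτ hne
    obtain ⟨ξ, hξ, p, hp, -, hd⟩ := ht h0 hτ
    refine ⟨_, ?_, hd⟩
    have h1 := inner_act_self_of_posDef (hΛ (x t).fst (x t).snd) ξ
    have h2 := inner_act_self_of_posDef (hΛ (x t).fst (x t).snd) p
    by_contra! hcon
    have h3 : 0 ≤ ε * ‖ξ‖ ^ 2 := by positivity
    have h4 : 0 ≤ ε * ‖p‖ ^ 2 := by positivity
    have hξ0 : ε * ‖ξ‖ ^ 2 = 0 := by linarith
    have hp0 : ε * ‖p‖ ^ 2 = 0 := by linarith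
    have hξ1 : ξ = 0 := by simpa [hε.ne'] using hξ0
    have hp1 : p = 0 := by simpa [hε.ne'] using hp0
    have hsnd : (x t).snd = 0 := by
      rw [hp1, hξ1] at hp
      simpa [act] using hp.symm
    have hfst : (x t).fst ≠ 0 := by
      intro h'
      apply hne
      rw [show x t = WithLp.toLp 2 ((x t).fst, (x t).snd) from rfl, hsnd, h']
      rfl
    have hxr : ‖x t‖ ≤ r := by
      have := hball t h0.le hτ
      rw [mem_ball_zero_iff] at this
      exact this.le
    have hσ : φ (x t).fst (x t).snd ≠ 0 := by
      rw [hsnd]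
      exact hrφ _ ((WithLp.norm_fst_le (Vec m) (x t)).trans hxr) hfst
    have h5 := hL _ hσ ξ hξ
    rw [hξ1, norm_zero] at h5
    have := mul_pos hc (Real.rpow_pos_of_pos (hUpos _ hσ) ρ)
    linarith
  refine ⟨hae, fun s t hs hst ht hne => ?_⟩
  have hcont := hx.continuousOn (hs.trans hst.le) ht
  have hnear : ∀ᶠ u in 𝓝[Set.Icc 0 t] s, x u ≠ 0 :=
    (hcont s ⟨hs, hst.le⟩).eventually_ne hne
  obtain ⟨δ, hδ, hδne⟩ := Metric.eventually_nhds_iff.1 (eventually_nhdsWithin_iff.1 hnear)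
  -- The curve may reach the origin before `t`. Strict decrease is needed only on a short initial
  -- interval, where continuity keeps it away from the origin; afterwards monotonicity suffices.
  set u := min t (s + δ / 2) with hu
  have hsu : s < u := lt_min hst (by linarith)
  have hut : u ≤ t := min_le_left _ _
  have huτ : (u : EReal) < τ := lt_of_le_of_lt (EReal.coe_le_coe_iff.2 hut) ht
  have hac := hlip.comp_absolutelyContinuousOnInterval (hx.1 u (hs.trans_lt hsu) huτ)
  have h1 : Hsmc U φ (x u) < Hsmc U φ (x s) := by
    refine (hac.mono (c := s) (d := u) ?_).lt_of_ae_deriv_neg hsu ?_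
    · rw [Set.uIcc_of_le hsu.le, Set.uIcc_of_le (hs.trans hsu.le)]
      exact Set.Icc_subset_Icc hs le_rfl
    · filter_upwards [hae] with v hv hvm
      refine hv (hs.trans_lt hvm.1) ((EReal.coe_lt_coe_iff.2 hvm.2).trans huτ) ?_
      refine hδne (y := v) ?_ ⟨hs.trans hvm.1.le, hvm.2.le.trans hut⟩
      rw [Real.dist_eq, abs_of_pos (by linarith [hvm.1])]
      have := hvm.2.trans_le (min_le_right _ _)
      linarith
  exact (Hsmc_le_of_isSolution hφ hq hη hU hε hΛ τ x hx u t (hs.trans hsu.le) hut ht).trans_lt h1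

/-- On the sliding surface `U ∘ σ` is constant, so its energy balance forces `ξ = 0`. What remains
is `Bᵀp = η`, and boundedness of `B` bounds `‖p‖` below by a multiple of `‖η‖`. -/
theorem tendsto_Hsmc_atTop (hφ : ContDiff ℝ 1 (fun p : Vec m × Vec m => φ p.1 p.2))
    (hq : ∀ q η, IsUnit (jacQ φ q η)) (hη : ∀ q η, IsUnit (jacEta φ q η))
    (hU : AdmissiblePotential U) (hε : 0 < ε)
    (hΛ : ∀ q η, (P.Lam φ q η - ε • (1 : Mat m)).PosDef)
    (hU0 : U 0 = 0) (hUpos : ∀ σ, σ ≠ 0 → 0 < U σ) {x : ℝ → State m}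
    (hx : IsSolution (P.closedLoop U φ) x ⊤) {r ts : ℝ} (hr : ∀ t, 0 ≤ t → ‖x t‖ ≤ r)
    (hts0 : 0 ≤ ts) (hts : ∀ t, ts ≤ t → φ (x t).fst (x t).snd = 0) :
    Tendsto (fun t => Hsmc U φ (x t)) atTop (𝓝 0) := by
  have hnn : ∀ y, 0 ≤ Hsmc U φ y := fun y => by
    have hUnn : 0 ≤ U (φ y.fst y.snd) := by
      by_cases h : φ y.fst y.snd = 0
      · rw [h, hU0]
      · exact (hUpos _ h).le
    rw [Hsmc]; positivity
  have hmono := Hsmc_le_of_isSolution hφ hq hη hU hε hΛ ⊤ x hx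
  obtain ⟨C₀, hC₀⟩ := (isCompact_closedBall (0 : State m) r).exists_bound_of_continuousOn
    (continuous_toEuclideanCLM.comp (continuous_jacEta hφ).matrix_transpose).continuousOn
  -- The maximum with `1` ensures that division by `C ^ 2` is legitimate.
  set C := max C₀ 1 with hC
  have hC1 : 0 < C := lt_max_of_lt_right one_pos
  set κ := ε / C ^ 2 with hκ
  have hκ0 : 0 < κ := by positivity
  -- on the sliding surface the Hamiltonian decays at a rate proportional to itself
  have hdecay : ∀ᵐ t : ℝ, ts < t → ∃ d ≤ -(κ * Hsmc U φ (x t)),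
      HasDerivAt (fun s => Hsmc U φ (x s)) d t := by
    filter_upwards [ae_dissipation hφ hq hη hU hx] with t ht htt
    have h0 : 0 < t := hts0.trans_lt htt
    obtain ⟨ξ, hξ, p, hp, hdU, hd⟩ := ht h0 (EReal.coe_lt_top t)
    refine ⟨_, ?_, hd⟩
    have hconst : HasDerivAt (fun s => U (φ (x s).fst (x s).snd)) 0 t := by
      refine (hasDerivAt_const t (0 : ℝ)).congr_of_eventuallyEq ?_
      filter_upwards [Ioi_mem_nhds htt] with s hs
      rw [hts s (le_of_lt (Set.mem_Ioi.1 hs)), hU0]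
    have h1 := hdU.unique hconst
    have h2 := inner_act_self_of_posDef (hΛ (x t).fst (x t).snd) ξ
    have h3 : 0 ≤ ε * ‖ξ‖ ^ 2 := by positivity
    have hξ0 : ε * ‖ξ‖ ^ 2 = 0 := by linarith
    have hξ1 : ξ = 0 := by simpa [hε.ne'] using hξ0
    have hsnd : act (jacEta φ (x t).fst (x t).snd)ᵀ p = (x t).snd := by
      rw [hξ1] at hp
      simpa [act] using hp
    have h4 : ‖(x t).snd‖ ≤ C * ‖p‖ := by
      rw [← hsnd]
      refine ((Matrix.toEuclideanCLM (𝕜 := ℝ) (jacEta φ (x t).fst (x t).snd)ᵀ).le_opNorm p).trans ?_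
      gcongr
      exact (hC₀ (x t) (by simpa using hr t h0.le)).trans (le_max_left _ _)
    have h5 := inner_act_self_of_posDef (hΛ (x t).fst (x t).snd) p
    have h6 : ‖(x t).snd‖ ^ 2 ≤ C ^ 2 * ‖p‖ ^ 2 := by
      rw [← mul_pow]; exact pow_le_pow_left₀ (norm_nonneg _) h4 2
    have h7 : κ * ‖(x t).snd‖ ^ 2 ≤ ε * ‖p‖ ^ 2 := by
      rw [hκ, div_mul_eq_mul_div, div_le_iff₀ (by positivity)]
      nlinarith
    rw [Hsmc, hts t htt.le, hU0, add_zero]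
    linarith
  rw [Metric.tendsto_nhds]
  intro e he
  obtain ⟨T, hT, hTe⟩ : ∃ T, ts ≤ T ∧ Hsmc U φ (x T) < e := by
    by_contra! hcon
    -- At a rate of at least `κ * e`, this time would consume more energy than is present at `ts`.
    set T := ts + (Hsmc U φ (x ts) / (κ * e) + 1) with hTdef
    have hpos : 0 ≤ Hsmc U φ (x ts) / (κ * e) := div_nonneg (hnn _) (by positivity)
    have htsT : ts ≤ T := by linarith
    have hT0 : 0 < T := by linarith
    have hac := (locallyLipschitz_Hsmc hφ hU.1).comp_absolutelyContinuousOnInterval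
      (hx.1 T hT0 (EReal.coe_lt_top T))
    have h1 := (hac.mono (c := ts) (d := T) (by
      rw [Set.uIcc_of_le htsT, Set.uIcc_of_le hT0.le]
      exact Set.Icc_subset_Icc hts0 le_rfl)).sub_le_of_ae_deriv_le (c := -(κ * e)) htsT (by
        filter_upwards [hdecay] with t ht htm
        obtain ⟨d, hd, hdd⟩ := ht htm.1
        refine ⟨d, hd.trans ?_, hdd⟩
        have := mul_le_mul_of_nonneg_left (hcon t htm.1.le) hκ0.le
        linarith)
    have h2 : κ * e * (T - ts) = Hsmc U φ (x ts) + κ * e := by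
      rw [hTdef]; field_simp; ring
    have h3 := hnn (x T)
    have h4 : 0 < κ * e := by positivity
    linarith
  filter_upwards [eventually_ge_atTop T] with t ht
  rw [Real.dist_eq, sub_zero, abs_of_nonneg (hnn _)]
  exact (hmono T t (hts0.trans hT) ht (EReal.coe_lt_top t)).trans_lt hTe

end Main

end PBSMC

/-! ### The theorem -/

open PBSMC in
theorem mainTheorem1 {m : ℕ} (P : MechanicalPH m) (U : Vec m → ℝ) (φ : Vec m → Vec m → Vec m)
    (hφ : ContDiff ℝ 1 (fun p : Vec m × Vec m => φ p.1 p.2)) (hφ0 : φ 0 0 = 0)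
    (hq : ∀ q η, IsUnit (jacQ φ q η)) (hη : ∀ q η, IsUnit (jacEta φ q η)) :
    -- the feedback converts the plant into the closed loop, wherever `∇U(σ)` exists
    (∀ x : State m, DifferentiableAt ℝ U (φ x.fst x.snd) →
      P.field x (P.feedback φ x (gradient U (φ x.fst x.snd))) =
        P.Jsmc φ x (gradient (Hsmc U φ) x)) ∧
    -- the same for the generalized gradients, at all states
    (LocallyLipschitz U → ∀ x : State m,
      (fun ξ => P.field x (P.feedback φ x ξ)) '' clarkeGradient U (φ x.fst x.snd) =
        P.closedLoop U φ x) ∧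
    (AdmissiblePotential U →
      (∃ ε : ℝ, 0 < ε ∧ ∀ q η, (P.Lam φ q η - ε • (1 : Mat m)).PosDef) →
      (U 0 = 0 ∧ ∀ σ, σ ≠ 0 → 0 < U σ) →
      (∃ c ρ : ℝ, 0 < c ∧ 0 ≤ ρ ∧ ρ < 1 / 2 ∧
        ∀ σ, σ ≠ 0 → ∀ ξ ∈ clarkeGradient U σ, c * U σ ^ ρ ≤ ‖ξ‖) →
      -- finite-time convergence of the sliding variable
      (∀ x₀ : State m, ∃ ts : ℝ, 0 ≤ ts ∧ ∀ (τ : EReal) (x : ℝ → State m), x 0 = x₀ →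
        IsSolution (P.closedLoop U φ) x τ →
        ∀ t : ℝ, ts ≤ t → (t : EReal) < τ → φ (x t).fst (x t).snd = 0) ∧
      -- asymptotic stability with the Lyapunov function `H_smc`
      AsymptoticallyStableAtOrigin (P.closedLoop U φ) ∧
      IsStrictLyapunovFunction (P.closedLoop U φ) (Hsmc U φ)) := by
  refine ⟨fun x hUx => ?_, fun hU x => ?_, ?_⟩
  · rw [field_feedback hq hη, gradient_Hsmc hφ x hUx]
  · rw [MechanicalPH.closedLoop, clarkeGradient_Hsmc hφ hq hU, Set.image_image]
    simp only [field_feedback hq hη]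
  · rintro hU ⟨ε, hε, hΛ⟩ ⟨hU0, hUpos⟩ ⟨c, ρ, hc, -, hρ, hL⟩
    have hreach := exists_reaching_time hφ hq hη hU hε hΛ hU0 hUpos hc hρ hL
    refine ⟨hreach, ?_, isStrictLyapunovFunction_Hsmc hφ hφ0 hq hη hU hε hΛ hU0 hUpos hc hL⟩
    obtain ⟨r, hr, hrφ⟩ := exists_ball_phi_ne_zero hφ hq
    have hlip := locallyLipschitz_Hsmc hφ hU.1
    have hJ := continuous_JsmcCLM (P := P) hφ hq hη
    obtain ⟨L, hbd⟩ := exists_bound_clarkeField hlip hJ r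
    have hpos := Hsmc_pos hUpos hU0 hrφ
    have hstab : StableAtOrigin (P.closedLoop U φ) :=
      stableAtOrigin_of_lyapunov (L := L) hr hlip.continuous (by simp [Hsmc, hφ0, hU0]) hpos
        (Hsmc_le_of_isSolution hφ hq hη hU hε hΛ)
        (fun y => (clarkeGradient_nonempty hlip y).image _) hbd
        (mem_clarkeField_of_forall hlip hJ (inner_JsmcCLM_neg hq hη hε hΛ))
    refine ⟨hstab, ?_⟩
    -- Stability with the radius `r` on which `H_smc` is positive definite keeps the solutions where
    -- decay of `H_smc` implies convergence.
    obtain ⟨δ, hδ, hδr⟩ := hstab r hr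
    refine ⟨δ, hδ, fun x hx hx0 => ?_⟩
    have hconf : ∀ t : ℝ, 0 ≤ t → ‖x t‖ ≤ r := fun t ht =>
      (((hδr (x 0) hx0).2 ⊤ x rfl hx).2 t ht (EReal.coe_lt_top t)).le
    obtain ⟨ts, hts0, hts⟩ := hreach (x 0)
    refine tendsto_zero_of_tendsto_lyapunov hlip.continuous hpos
      (by filter_upwards [eventually_ge_atTop 0] with t ht using hconf t ht) ?_
    exact tendsto_Hsmc_atTop hφ hq hη hU hε hΛ hU0 hUpos hx hconf hts0
      fun t ht => hts ⊤ x rfl hx t ht (EReal.coe_lt_top t)
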